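/- Let $q\ge 1$ be an integer, let $a<b$, and let $f:[a,b]\to\mathbb{R}$ have $q+1$ continuous derivatives. For $u\in[0,1]$ put $$F(u)=\bigl|f^{(q)}(a+u(b-a))\bigr|^{1/q},\qquad G(u)=\frac{\int_0^uF(t)\,dt}{\int_0^1F(t)\,dt},$$ and assume that $G$ is strictly increasing on $[0,1]$. For an integer $n\ge q$ define knots $k_0\le\dots\le k_{n+q-1}$ by $$k_j=0\ (0\le j\le q-1),\qquad k_j=G^{-1}\Bigl(\frac{j-q+1}{n-q+1}\Bigr)\ (q\le j\le n-1),\qquad k_j=1\ (n\le j\le n+q-1),$$ and let $I_j=[k_j,k_{j+1}]$ and $h_j=k_{j+1}-k_j$ for $q-1\le j\le n-1$. A B-spline of order $q$ with these knots is a function $C(u)=\sum_{j=0}^{n-1}P_jN_{j,q-1}(u)$ on $[0,1]$ with $P_j\in\mathbb{R}$, where the $N_{j,q-1}$ are the Cox–de Boor basis functions of degree $q-1$ (made left-continuous at $u=1$). Then for every real $M$ there is a constant $A>0$, depending only on $q,a,b,f,M$ and in particular neither on $n$ nor on the span $I_j$ or its width, with the following property. Let $n\ge q$ be such that the knot spans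 are locally quasi-uniform with constant $M$, that is, $h_j\le M h_{j+1}$ and $h_{j+1}\le M h_j$ for $q-1\le j\le n-2$. Let $C$ be a B-spline of order $q$ with knots $k_0,\dots,k_{n+q-1}$ that best approximates the function $u\mapsto f(a+u(b-a))$ on $[0,1]$, either in the sup norm or in the $L^2$ norm. Then for all $q-1\le j\le n-1$ $$\sup_{u\in I_j}\bigl|f(a+u(b-a))-C(u)\bigr|\le A\,\frac{\int_0^1F(t)\,dt}{n-q+1}.$$ For $[a,b]=[0,1]$ the right-hand side is $A\int_0^1|f^{(q)}(t)|^{1/q}\,dt\,/\,(n-q+1)$. -/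

import Mathlib

open Set

noncomputable section

namespace KnotPlacement

/-- The B-spline basis function `N_{j,p}` of degree `p` on the knots `k`, with parameter space
`[0,1]`, by the Cox–de Boor recurrence; terms with a zero denominator vanish. The spans are
half-open, except that the span ending at the right end `1` of the parameter space also contains
that point, so that splines are left-continuous at `1`. -/
def basis (k : ℕ → ℝ) : ℕ → ℕ → ℝ → ℝ
  | 0, j, u =>
      if (k j ≤ u ∧ u < k (j + 1)) ∨ (k j < 1 ∧ k (j + 1) = 1 ∧ u = 1) then 1 else 0
  | p + 1, j, u =>
      (u - k j) / (k (j + p + 1) - k j) * basis k p j u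
        + (k (j + p + 2) - u) / (k (j + p + 2) - k (j + 1)) * basis k p (j + 1) u

/-- The B-spline of order `q` (degree `q - 1`) on the knots `k_0, …, k_{n+q-1}` with control
points `P_0, …, P_{n-1}`. -/
def spline (q n : ℕ) (k : ℕ → ℝ) (P : Fin n → ℝ) (u : ℝ) : ℝ :=
  ∑ j : Fin n, P j * basis k (q - 1) j u

/-- `f : [a,b] → ℝ` as a function of the parameter `u ∈ [0,1]`. -/
def pullback (a b : ℝ) (f : ℝ → ℝ) (u : ℝ) : ℝ := f (a + u * (b - a))

/-- The feature function `F(u) = |f^{(q)}(a + u(b-a))|^{1/q}`. -/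
def feature (q : ℕ) (a b : ℝ) (f : ℝ → ℝ) (u : ℝ) : ℝ :=
  |iteratedDerivWithin q f (Icc a b) (a + u * (b - a))| ^ (1 / (q : ℝ))

/-- The feature CDF `G(u) = ∫₀ᵘ F / ∫₀¹ F`. -/
def featureCDF (q : ℕ) (a b : ℝ) (f : ℝ → ℝ) (u : ℝ) : ℝ :=
  (∫ t in (0 : ℝ)..u, feature q a b f t) / ∫ t in (0 : ℝ)..1, feature q a b f t

/-- The derivative-informed knots `k_0, …, k_{n+q-1}` (for `1 ≤ q ≤ n`): `q` knots at `0`, `q`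
knots at `1`, and `k_j = G⁻¹((j-q+1)/(n-q+1))` for `q ≤ j ≤ n-1`, where `G⁻¹` is the inverse of
the feature CDF on `[0,1]`. Values at indices above `n+q-1` are never used. -/
def knots (q : ℕ) (a b : ℝ) (f : ℝ → ℝ) (n j : ℕ) : ℝ :=
  if j < q then 0
  else if n ≤ j then 1
  else Function.invFunOn (featureCDF q a b f) (Icc 0 1)
    (((j : ℝ) - q + 1) / ((n : ℝ) - q + 1))

/-- Width `h_j = k_{j+1} - k_j` of the `j`-th knot span. -/
def width (k : ℕ → ℝ) (j : ℕ) : ℝ := k (j + 1) - k j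

/-- The spans `I_{q-1}, …, I_{n-1}` are locally quasi-uniform with constant `M`: the widths of
adjacent spans have ratio at most `M`. -/
def LocallyQuasiUniform (M : ℝ) (q n : ℕ) (k : ℕ → ℝ) : Prop :=
  ∀ j, q ≤ j + 1 → j + 1 < n →
    width k j ≤ M * width k (j + 1) ∧ width k (j + 1) ≤ M * width k j

/-- `spline q n k P` is a best approximation of `g` in the sup norm on `[0,1]`: every uniform
bound for the error of a competing spline also bounds its own error. -/
def IsBestUniform (q n : ℕ) (k : ℕ → ℝ) (g : ℝ → ℝ) (P : Fin n → ℝ) : Prop :=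
  ∀ (P' : Fin n → ℝ) (E : ℝ), (∀ u ∈ Icc (0 : ℝ) 1, |g u - spline q n k P' u| ≤ E) →
    ∀ u ∈ Icc (0 : ℝ) 1, |g u - spline q n k P u| ≤ E

/-- `spline q n k P` is the best approximation of `g` in `L²(0,1)`. -/
def IsBestL2 (q n : ℕ) (k : ℕ → ℝ) (g : ℝ → ℝ) (P : Fin n → ℝ) : Prop :=
  ∀ P' : Fin n → ℝ,
    ∫ u in (0 : ℝ)..1, (g u - spline q n k P u) ^ 2
      ≤ ∫ u in (0 : ℝ)..1, (g u - spline q n k P' u) ^ 2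

end KnotPlacement

end

/-!
The knots divide the integral of the feature function `F = |f^{(q)}|^{1/q}` into `N = n - q + 1`
equal parts. Write `p = q - 1`, `g` for the pulled-back function, and `N_j` for the B-splines.

*A good spline.* Marsden's identity `(u - τ)^p = ∑_j N_j(u) ψ_j(τ)` (`marsden`) and the de Boor–Fix
pairing `⟨g, ψ⟩(τ) = (1/p!) ∑_r (-1)^{p-r} g^{(r)}(τ) ψ^{(p-r)}(τ)`, whose derivative is
`g^{(p+1)} ψ / p!` (`hasDerivAt_pairing`), show that the spline with control points
`⟨g, ψ_j⟩(k_j)` differs from `g` on the `i`-th span by at most the integral of `|g^{(q)}|` over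
the spans nearby (`abs_sub_quasiInterpolant_le`). As `|g^{(q)}|` is a constant times `F^q`, and `F`
is bounded, this is `O(1/N)`. That settles the sup norm.

*The `L²` norm.* Let `s` be the difference of the best approximation and the good spline, and `e`
the error of the latter, so that `e - s` is orthogonal to all splines. The B-spline basis is locally
stable, with a constant that depends on the local mesh ratio (`exists_sq_coeff_mul_width_le`): a
control point is the pairing of the polynomial piece with `ψ_j`. Testing with
`∑_j ω_j c_j N_j`, where `c_j` are the control points of `s` and `ω` is a slowly varying weight,
gives `∑_i ω_i ∫_{I_i} s² ≤ 8 ∑_i ω_i ∫_{I_i} e²` (`weighted_energy_le`). With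
`ω_i = ρ^{|i-m|}` and `ρ` close to `1`, the value of `s` on the span `I_m` is controlled by the sum
of `ρ^{|i-m|} (h_i / h_m) sup_{I_i} e²`.

The ratio `h_i / h_m` may grow faster than `ρ^{|i-m|}` decays, so a bound `e = O(1/N)` does not
suffice. What helps is that `e` is small where spans are wide, since `F` is small there: as
`f ∈ C^{q+1}`, the function `F^q` is Lipschitz, so a value `F(t)` forces mass of order
`F(t) min(|J|, F(t)^q)` on an interval `J` around `t` (`IsDensity.mul_min_le_integral`), while the
mass of a span is only `O(1/N)`. For `q ≥ 2` it follows that `N² (h_i / h_m) sup_{I_i} e²` grows at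
most linearly in `|i - m|` (`Equidistributes.sq_integral_pow_mul_width_le`), which the weights
absorb. For `q = 1` the spans decouple and the weight may vanish off `I_m`.
-/

namespace KnotPlacement

open Polynomial

/-! ### The B-spline basis on a single knot span -/

/-- The point `u` lies in the `i`-th span: half-open, but the span that ends at `1` contains `1`. -/
def OnSpan (k : ℕ → ℝ) (i : ℕ) (u : ℝ) : Prop :=
  (k i ≤ u ∧ u < k (i + 1)) ∨ (k i < 1 ∧ k (i + 1) = 1 ∧ u = 1)

/-- Clamped knots for splines of degree `p` on `[0,1]` with `n` control points, the interior knots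
being simple. The sequence is continued by `1` after its last knot. -/
structure IsClamped (p n : ℕ) (k : ℕ → ℝ) : Prop where
  mono : Monotone k
  eq_zero : ∀ i ≤ p, k i = 0
  eq_one : ∀ i, n ≤ i → k i = 1
  lt_succ : ∀ i, p ≤ i → i < n → k i < k (i + 1)

namespace IsClamped

variable {p n : ℕ} {k : ℕ → ℝ}

lemma lt (hk : IsClamped p n k) : p < n := by
  by_contra! h
  have h1 := hk.eq_zero n h
  have h2 := hk.eq_one n le_rfl
  linarith

lemma nonneg (hk : IsClamped p n k) (i : ℕ) : 0 ≤ k i := by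
  rw [← hk.eq_zero 0 (Nat.zero_le _)]
  exact hk.mono (Nat.zero_le _)

lemma le_one (hk : IsClamped p n k) (i : ℕ) : k i ≤ 1 := by
  rw [← hk.eq_one (max n i) (le_max_left _ _)]
  exact hk.mono (le_max_right _ _)

lemma exists_onSpan (hk : IsClamped p n k) {u : ℝ} (hu : u ∈ Icc (0 : ℝ) 1) :
    ∃ i, p ≤ i ∧ i < n ∧ OnSpan k i u := by
  rcases lt_or_eq_of_le hu.2 with h | h
  · have hex : ∃ l, u < k l := ⟨n, by rw [hk.eq_one n le_rfl]; exact h⟩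
    classical
    have hl := Nat.find_spec hex
    have hpl : p < Nat.find hex := by
      by_contra! h'
      rw [hk.eq_zero _ h'] at hl
      linarith [hu.1]
    have hln : Nat.find hex ≤ n := Nat.find_min' hex (by rw [hk.eq_one n le_rfl]; exact h)
    refine ⟨Nat.find hex - 1, by omega, by omega, Or.inl ⟨?_, ?_⟩⟩
    · exact not_lt.1 (Nat.find_min hex (m := Nat.find hex - 1) (by omega))
    · rwa [Nat.sub_add_cancel (by omega)]
  · have hpn := hk.lt
    have h1 : k (n - 1 + 1) = 1 := hk.eq_one _ (by omega)
    refine ⟨n - 1, by omega, by omega, Or.inr ⟨?_, h1, h⟩⟩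
    rw [← h1]
    exact hk.lt_succ _ (by omega) (by omega)

lemma onSpan_unique (hk : IsClamped p n k) {u : ℝ} {i j : ℕ} (hi : OnSpan k i u)
    (hj : OnSpan k j u) : i = j := by
  have key : ∀ i j, OnSpan k i u → OnSpan k j u → ¬ i < j := by
    intro i j hi hj hij
    have h1 : k (i + 1) ≤ k j := hk.mono hij
    have h2 := hk.le_one (i + 1)
    have h3 := hk.le_one (j + 1)
    rcases hi with ⟨_, _⟩ | ⟨_, _, _⟩ <;> rcases hj with ⟨_, _⟩ | ⟨_, _, _⟩ <;> linarith
  have := key i j hi hj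
  have := key j i hj hi
  omega

end IsClamped

lemma OnSpan.mem_Icc {k : ℕ → ℝ} {i : ℕ} {u : ℝ} (h : OnSpan k i u) :
    u ∈ Icc (k i) (k (i + 1)) := by
  rcases h with h | h
  · exact ⟨h.1, h.2.le⟩
  · exact ⟨by rw [h.2.2]; exact h.1.le, by rw [h.2.1, h.2.2]⟩

/-- The polynomial that agrees with `N_{j,p}` on the `i`-th span: the Cox–de Boor recurrence
started from `δ_{ij}`. -/
noncomputable def spanPoly (k : ℕ → ℝ) (i : ℕ) : ℕ → ℕ → ℝ[X]
  | 0, j => if j = i then 1 else 0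
  | p + 1, j =>
      C (1 / (k (j + p + 1) - k j)) * (X - C (k j)) * spanPoly k i p j
        + C (1 / (k (j + p + 2) - k (j + 1))) * (C (k (j + p + 2)) - X) * spanPoly k i p (j + 1)

lemma basis_eq_eval_spanPoly {p n : ℕ} {k : ℕ → ℝ} (hk : IsClamped p n k) {i : ℕ} {u : ℝ}
    (hu : OnSpan k i u) (d j : ℕ) : basis k d j u = (spanPoly k i d j).eval u := by
  induction d generalizing j with
  | zero =>
    by_cases hj : j = i
    · subst hj
      have hu' : (k j ≤ u ∧ u < k (j + 1)) ∨ (k j < 1 ∧ k (j + 1) = 1 ∧ u = 1) := hu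
      simp [basis, spanPoly, hu']
    · have hu' : ¬ ((k j ≤ u ∧ u < k (j + 1)) ∨ (k j < 1 ∧ k (j + 1) = 1 ∧ u = 1)) :=
        fun h => hj (hk.onSpan_unique h hu)
      simp only [basis, spanPoly, if_neg hu', if_neg hj, eval_zero]
  | succ d ih =>
    simp only [basis, spanPoly, ih, eval_add, eval_mul, eval_C, eval_sub, eval_X]
    ring

lemma spanPoly_eq_zero_of_lt (k : ℕ → ℝ) {i d j : ℕ} (h : i < j) : spanPoly k i d j = 0 := by
  induction d generalizing j with
  | zero => simp [spanPoly, h.ne']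
  | succ d ih => simp [spanPoly, ih h, ih (h.trans (Nat.lt_succ_self j))]

lemma spanPoly_eq_zero_of_add_lt (k : ℕ → ℝ) {i d j : ℕ} (h : j + d < i) :
    spanPoly k i d j = 0 := by
  induction d generalizing j with
  | zero => simp [spanPoly, (show j ≠ i by omega)]
  | succ d ih => simp [spanPoly, ih (j := j) (by omega), ih (j := j + 1) (by omega)]

lemma natDegree_spanPoly_le (k : ℕ → ℝ) (i d j : ℕ) : (spanPoly k i d j).natDegree ≤ d := by
  induction d generalizing j with
  | zero => by_cases h : j = i <;> simp [spanPoly, h]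
  | succ d ih =>
    have h1 (a b : ℝ) : (C a * (X - C b)).natDegree ≤ 1 :=
      (natDegree_C_mul_le _ _).trans (natDegree_X_sub_C_le b)
    have h2 (a b : ℝ) : (C a * (C b - X)).natDegree ≤ 1 := by
      refine (natDegree_C_mul_le _ _).trans ?_
      rw [← neg_sub, natDegree_neg]
      exact natDegree_X_sub_C_le b
    rw [spanPoly]
    refine natDegree_add_le_of_degree_le ?_ ?_
    · have := natDegree_mul_le_of_le (h1 (1 / (k (j + d + 1) - k j)) (k j)) (ih j)
      omega
    · have := natDegree_mul_le_of_le
        (h2 (1 / (k (j + d + 2) - k (j + 1))) (k (j + d + 2))) (ih (j + 1))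
      omega

lemma eval_spanPoly_nonneg {k : ℕ → ℝ} (hk : Monotone k) {i : ℕ} {u : ℝ}
    (hu : u ∈ Icc (k i) (k (i + 1))) (d j : ℕ) : 0 ≤ (spanPoly k i d j).eval u := by
  induction d generalizing j with
  | zero => by_cases h : j = i <;> simp [spanPoly, h]
  | succ d ih =>
    simp only [spanPoly, eval_add, eval_mul, eval_C, eval_sub, eval_X]
    refine add_nonneg ?_ ?_
    · rcases lt_or_ge i j with h | h
      · simp [spanPoly_eq_zero_of_lt k h]
      · refine mul_nonneg (mul_nonneg (one_div_nonneg.2 ?_) ?_) (ih j)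
        · exact sub_nonneg.2 (hk (by omega))
        · exact sub_nonneg.2 ((hk h).trans hu.1)
    · rcases lt_or_ge (j + 1 + d) i with h | h
      · simp [spanPoly_eq_zero_of_add_lt k h]
      · refine mul_nonneg (mul_nonneg (one_div_nonneg.2 ?_) ?_) (ih (j + 1))
        · exact sub_nonneg.2 (hk (by omega))
        · exact sub_nonneg.2 (hu.2.trans (hk (by omega)))

/-- One step of the recurrence, summed against coefficients `A j`. For `d < i` the boundary terms
of the summation by parts vanish, and on a span of positive width no denominator is zero where it
matters. -/
lemma sum_mul_spanPoly_succ {k : ℕ → ℝ} {i d m : ℕ} (hd : d < i) (hm : i < m) (A : ℕ → ℝ) (u : ℝ) :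
    ∑ j ∈ Finset.range m, A (j + 1) * (spanPoly k i (d + 1) j).eval u
      = ∑ j ∈ Finset.range m, (A (j + 1) * (u - k j) + A j * (k (j + d + 1) - u))
          / (k (j + d + 1) - k j) * (spanPoly k i d j).eval u := by
  have hshift : ∑ j ∈ Finset.range m, A (j + 1) * ((k (j + d + 2) - u) /
        (k (j + d + 2) - k (j + 1))) * (spanPoly k i d (j + 1)).eval u
      = ∑ j ∈ Finset.range m, A j * ((k (j + d + 1) - u) /
        (k (j + d + 1) - k j)) * (spanPoly k i d j).eval u := by
    have h := Finset.sum_range_succ' (fun j => A j * ((k (j + d + 1) - u) /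
        (k (j + d + 1) - k j)) * (spanPoly k i d j).eval u) m
    rw [Finset.sum_range_succ, spanPoly_eq_zero_of_lt k hm,
      spanPoly_eq_zero_of_add_lt k (show 0 + d < i by omega)] at h
    simp only [eval_zero, mul_zero, add_zero] at h
    rw [h]
    refine Finset.sum_congr rfl fun j _ => ?_
    rw [show j + 1 + d + 1 = j + d + 2 by omega]
  have hsplit : ∑ j ∈ Finset.range m, A (j + 1) * (spanPoly k i (d + 1) j).eval u
      = ∑ j ∈ Finset.range m, A (j + 1) * ((u - k j) / (k (j + d + 1) - k j))
          * (spanPoly k i d j).eval u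
        + ∑ j ∈ Finset.range m, A (j + 1) * ((k (j + d + 2) - u) /
        (k (j + d + 2) - k (j + 1))) * (spanPoly k i d (j + 1)).eval u := by
    rw [← Finset.sum_add_distrib]
    refine Finset.sum_congr rfl fun j _ => ?_
    simp only [spanPoly, eval_add, eval_mul, eval_C, eval_sub, eval_X]
    ring
  rw [hsplit, hshift, ← Finset.sum_add_distrib]
  refine Finset.sum_congr rfl fun j _ => ?_
  ring

lemma spanPoly_denom_ne_zero {k : ℕ → ℝ} (hk : Monotone k) {i d j : ℕ} (hi : k i < k (i + 1))
    (h : spanPoly k i d j ≠ 0) : k (j + d + 1) - k j ≠ 0 := by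
  have h1 : j ≤ i := not_lt.1 fun h' => h (spanPoly_eq_zero_of_lt k h')
  have h2 : i ≤ j + d := not_lt.1 fun h' => h (spanPoly_eq_zero_of_add_lt k h')
  have h3 := hk h1
  have h4 : k (i + 1) ≤ k (j + d + 1) := hk (by omega)
  exact ne_of_gt (by linarith)

/-- The polynomial `∏_{l=1}^{p} (k_{j+l} - X)` attached to `N_{j,p}` by Marsden's identity. -/
noncomputable def dualPoly (k : ℕ → ℝ) (p j : ℕ) : ℝ[X] :=
  ∏ l ∈ Finset.range p, (C (k (j + l + 1)) - X)

/-- The partition of unity. -/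
lemma sum_eval_spanPoly {k : ℕ → ℝ} (hk : Monotone k) {i d m : ℕ} (hi : k i < k (i + 1))
    (hd : d ≤ i) (hm : i < m) (u : ℝ) :
    ∑ j ∈ Finset.range m, (spanPoly k i d j).eval u = 1 := by
  induction d with
  | zero => simp [spanPoly, apply_ite, hm]
  | succ d ih =>
    have h := sum_mul_spanPoly_succ (k := k) (d := d) hd hm (fun _ => 1) u
    simp only [one_mul] at h
    rw [h, ← ih (by omega)]
    refine Finset.sum_congr rfl fun j _ => ?_
    by_cases h0 : spanPoly k i d j = 0
    · simp [h0]
    · rw [show u - k j + (k (j + d + 1) - u) = k (j + d + 1) - k j by ring,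
        div_self (spanPoly_denom_ne_zero hk hi h0), one_mul]

/-- Marsden's identity on the `i`-th span. -/
lemma marsden {k : ℕ → ℝ} (hk : Monotone k) {i d m : ℕ} (hi : k i < k (i + 1))
    (hd : d ≤ i) (hm : i < m) (u : ℝ) :
    (C u - X) ^ d
      = ∑ j ∈ Finset.range m, C ((spanPoly k i d j).eval u) * dualPoly k d j := by
  refine Polynomial.funext fun t => ?_
  simp only [eval_pow, eval_sub, eval_C, eval_X, eval_finsetSum, eval_mul, dualPoly, eval_prod]
  induction d with
  | zero => simp [spanPoly, apply_ite, hm]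
  | succ d ih =>
    have h := sum_mul_spanPoly_succ (k := k) (d := d) hd hm
      (fun j => ∏ l ∈ Finset.range (d + 1), (k (j + l) - t)) u
    have e : ∑ j ∈ Finset.range m, (spanPoly k i (d + 1) j).eval u *
          ∏ l ∈ Finset.range (d + 1), (k (j + l + 1) - t)
        = ∑ j ∈ Finset.range m, (∏ l ∈ Finset.range (d + 1), (k (j + 1 + l) - t)) *
          (spanPoly k i (d + 1) j).eval u := by
      refine Finset.sum_congr rfl fun j _ => ?_
      rw [mul_comm]
      congr 1
      refine Finset.prod_congr rfl fun l _ => ?_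
      rw [show j + 1 + l = j + l + 1 by omega]
    rw [e, h, pow_succ, ih (by omega), Finset.sum_mul]
    refine Finset.sum_congr rfl fun j _ => ?_
    by_cases h0 : spanPoly k i d j = 0
    · simp [h0]
    · have hne := spanPoly_denom_ne_zero hk hi h0
      have e1 : ∏ l ∈ Finset.range (d + 1), (k (j + 1 + l) - t)
          = (∏ l ∈ Finset.range d, (k (j + l + 1) - t)) * (k (j + d + 1) - t) := by
        rw [Finset.prod_range_succ, show j + 1 + d = j + d + 1 by omega]
        congr 1
        refine Finset.prod_congr rfl fun l _ => ?_
        rw [show j + 1 + l = j + l + 1 by omega]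
      have e2 : ∏ l ∈ Finset.range (d + 1), (k (j + l) - t)
          = (∏ l ∈ Finset.range d, (k (j + l + 1) - t)) * (k j - t) := by
        rw [Finset.prod_range_succ', add_zero]
        rfl
      rw [e1, e2]
      field_simp
      ring

/-- On a span, a spline is a convex combination of its active control points. -/
lemma abs_sum_mul_spanPoly_le {k : ℕ → ℝ} (hk : Monotone k) {i d m : ℕ} (hi : k i < k (i + 1))
    (hd : d ≤ i) (hm : i < m) {u : ℝ} (hu : u ∈ Icc (k i) (k (i + 1))) {c : ℕ → ℝ} {B : ℝ}
    (hc : ∀ j, j ≤ i → i ≤ j + d → |c j| ≤ B) :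
    |∑ j ∈ Finset.range m, c j * (spanPoly k i d j).eval u| ≤ B := by
  calc |∑ j ∈ Finset.range m, c j * (spanPoly k i d j).eval u|
      ≤ ∑ j ∈ Finset.range m, |c j * (spanPoly k i d j).eval u| := Finset.abs_sum_le_sum_abs _ _
    _ ≤ ∑ j ∈ Finset.range m, B * (spanPoly k i d j).eval u := by
        refine Finset.sum_le_sum fun j _ => ?_
        have h0 := eval_spanPoly_nonneg hk hu d j
        rw [abs_mul, abs_of_nonneg h0]
        by_cases hz : spanPoly k i d j = 0
        · simp [hz]
        · have h1 : j ≤ i := not_lt.1 fun h' => hz (spanPoly_eq_zero_of_lt k h')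
          have h2 : i ≤ j + d := not_lt.1 fun h' => hz (spanPoly_eq_zero_of_add_lt k h')
          exact mul_le_mul_of_nonneg_right (hc j h1 h2) h0
    _ = B := by rw [← Finset.mul_sum, sum_eval_spanPoly hk hi hd hm, mul_one]

/-! ### The de Boor–Fix pairing and the quasi-interpolant -/

/-- The de Boor–Fix pairing `(1/p!) ∑_r (-1)^{p-r} γ_r(τ) ψ^{(p-r)}(τ)` of a function, given by the
sequence `γ` of its derivatives, with a polynomial `ψ`. -/
noncomputable def pairing (p : ℕ) (γ : ℕ → ℝ → ℝ) (ψ : ℝ[X]) (τ : ℝ) : ℝ :=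
  (1 / (p.factorial : ℝ)) * ∑ r ∈ Finset.range (p + 1),
    (-1) ^ (p - r) * γ r τ * (derivative^[p - r] ψ).eval τ

lemma pairing_sum (p : ℕ) (γ : ℕ → ℝ → ℝ) (m : ℕ) (c : ℕ → ℝ) (ψ : ℕ → ℝ[X]) (τ : ℝ) :
    pairing p γ (∑ j ∈ Finset.range m, C (c j) * ψ j) τ
      = ∑ j ∈ Finset.range m, c j * pairing p γ (ψ j) τ := by
  simp only [pairing, iterate_derivative_sum, iterate_derivative_C_mul, eval_finsetSum, eval_mul,
    eval_C, Finset.mul_sum]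
  rw [Finset.sum_comm]
  refine Finset.sum_congr rfl fun j _ => Finset.sum_congr rfl fun r _ => ?_
  ring

/-- Pairing with `(u - X)^p` at `u` itself evaluates the function at `u`. -/
lemma pairing_sub_pow (p : ℕ) (γ : ℕ → ℝ → ℝ) (u : ℝ) :
    pairing p γ ((C u - X) ^ p) u = γ 0 u := by
  have e : (C u - X : ℝ[X]) ^ p = C ((-1) ^ p) * (X - C u) ^ p := by
    rw [← neg_sub, neg_pow]
    simp
  rw [pairing, Finset.sum_eq_single 0]
  · rw [e, Nat.sub_zero, iterate_derivative_C_mul, iterate_derivative_X_sub_pow_self]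
    have h2 : ((-1 : ℝ) ^ p) * (-1) ^ p = 1 := by rw [← mul_pow]; norm_num
    have h3 : (p.factorial : ℝ) ≠ 0 := by positivity
    simp only [eval_mul, eval_C, eval_natCast]
    field_simp
    linear_combination (γ 0 u) * h2
  · intro r hr hr0
    rw [e, iterate_derivative_C_mul, iterate_derivative_X_sub_pow]
    have : p - (p - r) ≠ 0 := by
      have := Finset.mem_range.1 hr
      omega
    simp [this]
  · simp

/-- The derivative of the pairing telescopes to a single term. -/
lemma hasDerivAt_pairing {p : ℕ} {γ : ℕ → ℝ → ℝ} {ψ : ℝ[X]} (hψ : ψ.natDegree ≤ p) {τ : ℝ}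
    (hγ : ∀ r ≤ p, HasDerivAt (γ r) (γ (r + 1) τ) τ) :
    HasDerivAt (pairing p γ ψ) ((1 / (p.factorial : ℝ)) * (γ (p + 1) τ * ψ.eval τ)) τ := by
  have hsum : HasDerivAt (fun τ => ∑ r ∈ Finset.range (p + 1),
      (-1) ^ (p - r) * γ r τ * (derivative^[p - r] ψ).eval τ)
      (∑ r ∈ Finset.range (p + 1), ((-1) ^ (p - r) * γ (r + 1) τ * (derivative^[p - r] ψ).eval τ
        + (-1) ^ (p - r) * γ r τ * (derivative^[p - r + 1] ψ).eval τ)) τ := by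
    refine HasDerivAt.fun_sum fun r hr => ?_
    have hr' : r ≤ p := by have := Finset.mem_range.1 hr; omega
    rw [Function.iterate_succ_apply']
    exact ((hγ r hr').const_mul _).mul ((derivative^[p - r] ψ).hasDerivAt τ)
  have htel : ∑ r ∈ Finset.range (p + 1), ((-1) ^ (p - r) * γ (r + 1) τ *
        (derivative^[p - r] ψ).eval τ
        + (-1) ^ (p - r) * γ r τ * (derivative^[p - r + 1] ψ).eval τ) = γ (p + 1) τ * ψ.eval τ := by
    have h := Finset.sum_range_sub
      (fun r => (-1 : ℝ) ^ (p + 1 - r) * γ r τ * (derivative^[p + 1 - r] ψ).eval τ) (p + 1)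
    rw [Nat.sub_zero, iterate_derivative_eq_zero (p := ψ) (x := p + 1) (by omega)] at h
    simp only [Nat.sub_self, pow_zero, one_mul, Function.iterate_zero, id, eval_zero, mul_zero,
      sub_zero] at h
    rw [← h]
    refine Finset.sum_congr rfl fun r hr => ?_
    have hr' : r ≤ p := by have := Finset.mem_range.1 hr; omega
    rw [show p + 1 - (r + 1) = p - r by omega, show p + 1 - r = p - r + 1 by omega, pow_succ]
    ring
  rw [htel] at hsum
  exact hsum.const_mul _

lemma natDegree_prod_C_sub_X_le (x : ℕ → ℝ) (p : ℕ) :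
    (∏ l ∈ Finset.range p, (C (x l) - X)).natDegree ≤ p := by
  refine (natDegree_prod_le _ _).trans ?_
  refine (Finset.sum_le_card_nsmul _ _ 1 fun l _ => ?_).trans (by simp)
  rw [← neg_sub, natDegree_neg]
  exact natDegree_X_sub_C_le _

lemma natDegree_dualPoly_le (k : ℕ → ℝ) (p j : ℕ) : (dualPoly k p j).natDegree ≤ p :=
  natDegree_prod_C_sub_X_le _ p

lemma abs_eval_dualPoly_le_one {k : ℕ → ℝ} {p n : ℕ} (hk : IsClamped p n k) (j : ℕ) {τ : ℝ}
    (hτ : τ ∈ Icc (0 : ℝ) 1) : |(dualPoly k p j).eval τ| ≤ 1 := by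
  rw [dualPoly, eval_prod, Finset.abs_prod]
  refine Finset.prod_le_one (fun _ _ => abs_nonneg _) fun l _ => ?_
  have h1 := hk.nonneg (j + l + 1)
  have h2 := hk.le_one (j + l + 1)
  rw [eval_sub, eval_C, eval_X, abs_le]
  constructor <;> linarith [hτ.1, hτ.2]

lemma eval_derivative_eq_zero_of_natDegree_le {p : ℕ} {s : ℝ[X]} (hs : s.natDegree ≤ p) (τ : ℝ) :
    (derivative^[p + 1] s).eval τ = 0 := by
  rw [iterate_derivative_eq_zero (by omega), eval_zero]

/-- The functions `γ 0, …, γ m` are continuous on `[0,1]`, and each is the derivative of the one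
before it on `(0,1)`. -/
structure IsDerivSeq (m : ℕ) (γ : ℕ → ℝ → ℝ) : Prop where
  continuousOn : ∀ r ≤ m, ContinuousOn (γ r) (Icc 0 1)
  hasDerivAt : ∀ r < m, ∀ u ∈ Ioo (0 : ℝ) 1, HasDerivAt (γ r) (γ (r + 1) u) u

lemma continuousOn_pairing {p : ℕ} {γ : ℕ → ℝ → ℝ} (hγ : IsDerivSeq (p + 1) γ) (ψ : ℝ[X]) :
    ContinuousOn (pairing p γ ψ) (Icc 0 1) := by
  refine continuousOn_const.mul (continuousOn_finsetSum _ fun r hr => ?_)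
  have hr' : r ≤ p + 1 := by have := Finset.mem_range.1 hr; omega
  exact (continuousOn_const.mul (hγ.continuousOn r hr')).mul (Polynomial.continuousOn _)

lemma abs_pairing_sub_le {p : ℕ} {γ : ℕ → ℝ → ℝ} (hγ : IsDerivSeq (p + 1) γ) {ψ : ℝ[X]}
    (hψ : ψ.natDegree ≤ p) (hψ1 : ∀ τ ∈ Icc (0 : ℝ) 1, |ψ.eval τ| ≤ 1) {x y : ℝ} (hx : 0 ≤ x)
    (hxy : x ≤ y) (hy : y ≤ 1) :
    |pairing p γ ψ y - pairing p γ ψ x| ≤ ∫ t in x..y, |γ (p + 1) t| := by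
  have hsub : Icc x y ⊆ Icc (0 : ℝ) 1 := Icc_subset_Icc hx hy
  have hc : ContinuousOn (fun τ => (1 / (p.factorial : ℝ)) * (γ (p + 1) τ * ψ.eval τ)) (Icc x y) :=
    continuousOn_const.mul
      (((hγ.continuousOn _ le_rfl).mono hsub).mul (Polynomial.continuousOn _))
  have hft := intervalIntegral.integral_eq_sub_of_hasDerivAt_of_le hxy
    ((continuousOn_pairing hγ ψ).mono hsub)
    (fun τ hτ => hasDerivAt_pairing hψ fun r hr => hγ.hasDerivAt r (by omega) τ
      ⟨hx.trans_lt hτ.1, hτ.2.trans_le hy⟩)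
    (hc.intervalIntegrable_of_Icc hxy)
  rw [← hft]
  refine (intervalIntegral.abs_integral_le_integral_abs hxy).trans ?_
  refine intervalIntegral.integral_mono_on hxy (hc.abs.intervalIntegrable_of_Icc hxy)
    (((hγ.continuousOn _ le_rfl).mono hsub).abs.intervalIntegrable_of_Icc hxy) fun τ hτ => ?_
  have h1 : (1 : ℝ) ≤ p.factorial := by exact_mod_cast Nat.one_le_iff_ne_zero.2 p.factorial_ne_zero
  have h2 : 1 / (p.factorial : ℝ) ≤ 1 := by rw [div_le_one (by linarith)]; exact h1
  rw [abs_mul, abs_mul, abs_of_nonneg (by positivity : 0 ≤ 1 / (p.factorial : ℝ))]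
  calc 1 / (p.factorial : ℝ) * (|γ (p + 1) τ| * |ψ.eval τ|)
      ≤ 1 * (|γ (p + 1) τ| * 1) := by
        gcongr
        exact hψ1 τ (hsub hτ)
    _ = |γ (p + 1) τ| := by ring

/-- The control points `⟨γ, ψ_j⟩(k_j)` of the quasi-interpolant reproduce the function up to the
mass of its `(p+1)`-st derivative near the span: by Marsden's identity the error at `u` is
`∑_j N_j(u) (⟨γ, ψ_j⟩(u) - ⟨γ, ψ_j⟩(k_j))`. -/
lemma abs_sub_quasiInterpolant_le {p n : ℕ} {k : ℕ → ℝ} (hk : IsClamped p n k) {γ : ℕ → ℝ → ℝ}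
    (hγ : IsDerivSeq (p + 1) γ) {i : ℕ} (hpi : p ≤ i) (hin : i < n) {u : ℝ}
    (hu : u ∈ Icc (k i) (k (i + 1))) :
    |γ 0 u - ∑ j ∈ Finset.range n,
        pairing p γ (dualPoly k p j) (k j) * (spanPoly k i p j).eval u|
      ≤ ∫ t in k (i - p)..k (i + 1), |γ (p + 1) t| := by
  have hi := hk.lt_succ i hpi hin
  have h0 : γ 0 u = ∑ j ∈ Finset.range n,
      (spanPoly k i p j).eval u * pairing p γ (dualPoly k p j) u := by
    rw [← pairing_sub_pow p γ u, marsden hk.mono hi hpi hin u, pairing_sum]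
  have e : γ 0 u - ∑ j ∈ Finset.range n,
        pairing p γ (dualPoly k p j) (k j) * (spanPoly k i p j).eval u
      = ∑ j ∈ Finset.range n, (pairing p γ (dualPoly k p j) u
          - pairing p γ (dualPoly k p j) (k j)) * (spanPoly k i p j).eval u := by
    rw [h0, ← Finset.sum_sub_distrib]
    exact Finset.sum_congr rfl fun j _ => by ring
  rw [e]
  refine abs_sum_mul_spanPoly_le hk.mono hi hpi hin hu fun j hji hij => ?_
  have hju : k j ≤ u := (hk.mono hji).trans hu.1
  have hu1 : u ≤ 1 := hu.2.trans (hk.le_one _)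
  refine (abs_pairing_sub_le hγ (natDegree_dualPoly_le k p j)
    (fun τ hτ => abs_eval_dualPoly_le_one hk j hτ) (hk.nonneg j) hju hu1).trans ?_
  have hsub : uIcc (k (i - p)) (k (i + 1)) ⊆ Icc 0 1 := by
    rw [uIcc_of_le (hk.mono (by omega))]
    exact Icc_subset_Icc (hk.nonneg _) (hk.le_one _)
  exact intervalIntegral.integral_mono_interval (hk.mono (by omega)) hju hu.2
    (Filter.Eventually.of_forall fun _ => abs_nonneg _)
    (((hγ.continuousOn _ le_rfl).mono hsub).abs.intervalIntegrable)

/-! ### Local stability of the B-spline basis -/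

/-- A spline with control points `c`, as a polynomial on the `i`-th span. -/
noncomputable def splinePoly (k : ℕ → ℝ) (i p m : ℕ) (c : ℕ → ℝ) : ℝ[X] :=
  ∑ j ∈ Finset.range m, C (c j) * spanPoly k i p j

lemma eval_splinePoly (k : ℕ → ℝ) (i p m : ℕ) (c : ℕ → ℝ) (u : ℝ) :
    (splinePoly k i p m c).eval u = ∑ j ∈ Finset.range m, c j * (spanPoly k i p j).eval u := by
  simp [splinePoly, eval_finsetSum]

lemma natDegree_splinePoly_le (k : ℕ → ℝ) (i p m : ℕ) (c : ℕ → ℝ) :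
    (splinePoly k i p m c).natDegree ≤ p :=
  natDegree_sum_le_of_forall_le _ _ fun j _ =>
    (natDegree_C_mul_le _ _).trans (natDegree_spanPoly_le k i p j)

lemma splinePoly_eq_sum_window {k : ℕ → ℝ} {i p m : ℕ} (hp : p ≤ i) (hm : i < m) (c : ℕ → ℝ) :
    splinePoly k i p m c
      = ∑ l : Fin (p + 1), C (c (i - p + l)) * spanPoly k i p (i - p + l) := by
  rw [Fin.sum_univ_eq_sum_range (fun l => C (c (i - p + l)) * spanPoly k i p (i - p + l)) (p + 1),
    splinePoly]
  have hsub : Finset.Ico (i - p) (i + 1) ⊆ Finset.range m := by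
    intro j hj
    rw [Finset.mem_Ico] at hj
    rw [Finset.mem_range]
    omega
  rw [← Finset.sum_subset hsub, Finset.sum_Ico_eq_sum_range]
  · rw [show i + 1 - (i - p) = p + 1 by omega]
  · intro j _ hj
    rw [Finset.mem_Ico, not_and_or] at hj
    rcases hj with hj | hj
    · rw [spanPoly_eq_zero_of_add_lt k (by omega), mul_zero]
    · rw [spanPoly_eq_zero_of_lt k (by omega), mul_zero]

/-- A polynomial of degree at most `p` is, on each span, the spline with control points given by
the de Boor–Fix pairing, which may be taken at any point `τ`. -/
lemma splinePoly_pairing_eq {k : ℕ → ℝ} (hk : Monotone k) {i p m : ℕ} (hi : k i < k (i + 1))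
    (hp : p ≤ i) (hm : i < m) {s : ℝ[X]} (hs : s.natDegree ≤ p) (τ : ℝ) :
    splinePoly k i p m
      (fun j => pairing p (fun r u => (derivative^[r] s).eval u) (dualPoly k p j) τ) = s := by
  have hconst (j : ℕ) (u : ℝ) : pairing p (fun r u => (derivative^[r] s).eval u) (dualPoly k p j) τ
      = pairing p (fun r u => (derivative^[r] s).eval u) (dualPoly k p j) u := by
    have hd (v : ℝ) := hasDerivAt_pairing (γ := fun r u => (derivative^[r] s).eval u)
      (natDegree_dualPoly_le k p j) (τ := v) (fun r _ => by
        simp only [Function.iterate_succ_apply']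
        exact (derivative^[r] s).hasDerivAt v)
    refine is_const_of_deriv_eq_zero (fun v => (hd v).differentiableAt) (fun v => ?_) τ u
    rw [(hd v).deriv, eval_derivative_eq_zero_of_natDegree_le hs]
    ring
  refine Polynomial.funext fun u => ?_
  rw [eval_splinePoly]
  have h := pairing_sub_pow p (fun r u => (derivative^[r] s).eval u) u
  rw [marsden hk hi hp hm u, pairing_sum] at h
  simp only [Function.iterate_zero, id] at h
  rw [← h]
  exact Finset.sum_congr rfl fun j _ => by rw [hconst j u, mul_comm]

/-- The active control points are recovered from the polynomial: the map from control points to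
polynomials of degree at most `p` is onto, between spaces of the same dimension. -/
lemma pairing_splinePoly {k : ℕ → ℝ} (hk : Monotone k) {i p m : ℕ} (hi : k i < k (i + 1))
    (hp : p ≤ i) (hm : i < m) (c : ℕ → ℝ) (τ : ℝ) {j : ℕ} (hji : j ≤ i) (hij : i ≤ j + p) :
    pairing p (fun r u => (derivative^[r] (splinePoly k i p m c)).eval u) (dualPoly k p j) τ
      = c j := by
  let T : (Fin (p + 1) → ℝ) →ₗ[ℝ] degreeLT ℝ (p + 1) :=
    { toFun := fun a => ⟨∑ l : Fin (p + 1), C (a l) * spanPoly k i p (i - p + l), by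
        rw [mem_degreeLT]
        refine degree_le_natDegree.trans_lt (Nat.cast_lt.2 (Nat.lt_succ_of_le ?_))
        exact natDegree_sum_le_of_forall_le _ _ fun l _ =>
          (natDegree_C_mul_le _ _).trans (natDegree_spanPoly_le k i p _)⟩
      map_add' := fun a b => by
        ext1
        simp [add_mul, Finset.sum_add_distrib]
      map_smul' := fun r a => by
        ext1
        simp [smul_eq_C_mul, Finset.mul_sum, mul_assoc] }
  have hT (c : ℕ → ℝ) : (T (fun l => c (i - p + l)) : ℝ[X]) = splinePoly k i p m c :=
    (splinePoly_eq_sum_window hp hm c).symm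
  have hsurj : Function.Surjective T := by
    intro s
    have hs : (s : ℝ[X]).natDegree ≤ p := by
      have := mem_degreeLT.1 s.2
      exact natDegree_le_of_degree_le (Order.le_of_lt_succ (by exact_mod_cast this))
    refine ⟨_, Subtype.ext ((hT _).trans (splinePoly_pairing_eq hk hi hp hm hs τ))⟩
  have hfin : Module.finrank ℝ (Fin (p + 1) → ℝ) = Module.finrank ℝ (degreeLT ℝ (p + 1)) :=
    (degreeLTEquiv ℝ (p + 1)).finrank_eq.symm
  have : FiniteDimensional ℝ (degreeLT ℝ (p + 1)) :=
    (degreeLTEquiv ℝ (p + 1)).symm.finiteDimensional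
  have hinj : Function.Injective T :=
    (LinearMap.injective_iff_surjective_of_finrank_eq_finrank hfin).2 hsurj
  have heq := hinj (Subtype.ext ((hT _).trans ((splinePoly_pairing_eq hk hi hp hm
    (natDegree_splinePoly_le k i p m c) τ).trans (hT c).symm)))
  have := congrFun heq ⟨j - (i - p), by omega⟩
  simp only [show i - p + (j - (i - p)) = j by omega] at this
  exact this

/-- On polynomials of degree at most `p`, the coefficients are controlled by the `L²(0,1)` norm,
by compactness of the unit sphere of coefficient vectors. -/
lemma exists_sq_coeff_le_integral (p : ℕ) : ∃ K : ℝ, 0 < K ∧ ∀ a : ℕ → ℝ, ∀ r ≤ p,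
    a r ^ 2 ≤ K * ∫ v in (0 : ℝ)..1, (∑ l ∈ Finset.range (p + 1), a l * v ^ l) ^ 2 := by
  let Q : (Fin (p + 1) → ℝ) → ℝ := fun a => ∫ v in (0 : ℝ)..1, (∑ l, a l * v ^ (l : ℕ)) ^ 2
  have hQcont : Continuous Q := by
    have hc : Continuous fun x : (Fin (p + 1) → ℝ) × ℝ => (∑ l, x.1 l * x.2 ^ (l : ℕ)) ^ 2 := by
      fun_prop
    exact intervalIntegral.continuous_parametric_intervalIntegral_of_continuous' hc 0 1
  have hQpos : ∀ a, a ≠ 0 → 0 < Q a := by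
    intro a ha
    let s : ℝ[X] := ∑ l : Fin (p + 1), C (a l) * X ^ (l : ℕ)
    have hs (v : ℝ) : s.eval v = ∑ l, a l * v ^ (l : ℕ) := by simp [s, eval_finsetSum]
    have hs0 : s ≠ 0 := by
      intro h
      refine ha (funext fun l => ?_)
      have := congrArg (fun q => coeff q (l : ℕ)) h
      simpa [s, finsetSum_coeff, coeff_X_pow, Fin.val_inj] using this
    have hex : ∃ v ∈ Icc (0 : ℝ) 1, 0 < (∑ l, a l * v ^ (l : ℕ)) ^ 2 := by
      by_contra! hcon
      refine hs0 (eq_zero_of_infinite_isRoot s ((Icc_infinite (zero_lt_one' ℝ)).mono fun v hv => ?_))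
      have := hcon v hv
      rw [mem_ofPred_eq, IsRoot.def, hs]
      exact pow_eq_zero_iff (two_ne_zero) |>.1 (le_antisymm this (sq_nonneg _))
    exact intervalIntegral.integral_pos zero_lt_one
      (Continuous.continuousOn (by fun_prop)) (fun v _ => sq_nonneg _) hex
  have hne : (Metric.sphere (0 : Fin (p + 1) → ℝ) 1).Nonempty :=
    NormedSpace.sphere_nonempty.2 zero_le_one
  obtain ⟨a₀, ha₀, hmin⟩ := (isCompact_sphere (0 : Fin (p + 1) → ℝ) 1).exists_isMinOn hne
    hQcont.continuousOn
  have hm : 0 < Q a₀ := hQpos a₀ (by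
    rintro rfl
    simp at ha₀)
  refine ⟨(Q a₀)⁻¹, inv_pos.2 hm, fun a r hr => ?_⟩
  let b : Fin (p + 1) → ℝ := fun l => a l
  have hb : ∫ v in (0 : ℝ)..1, (∑ l ∈ Finset.range (p + 1), a l * v ^ l) ^ 2 = Q b := by
    simp only [Q, b]
    congr 1
    ext v
    rw [Fin.sum_univ_eq_sum_range (fun l => a l * v ^ l)]
  have hle : Q a₀ * ‖b‖ ^ 2 ≤ Q b := by
    by_cases h0 : b = 0
    · simp [h0, Q]
    · have hnorm : 0 < ‖b‖ := norm_pos_iff.2 h0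
      have h1 : Q a₀ ≤ Q (‖b‖⁻¹ • b) := hmin (by
        simp [norm_smul, inv_mul_cancel₀ hnorm.ne'])
      have h2 : Q (‖b‖⁻¹ • b) = (‖b‖⁻¹) ^ 2 * Q b := by
        simp only [Q, ← intervalIntegral.integral_const_mul]
        congr 1
        ext v
        rw [← mul_pow, Finset.mul_sum]
        simp [mul_assoc]
      rw [h2, inv_pow, inv_mul_eq_div, le_div_iff₀ (by positivity)] at h1
      exact h1
  have hbr : a r ^ 2 ≤ ‖b‖ ^ 2 := by
    have := norm_le_pi_norm b ⟨r, by omega⟩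
    rw [← sq_abs]
    exact pow_le_pow_left₀ (abs_nonneg _) this 2
  rw [hb, inv_mul_eq_div, le_div_iff₀ hm, mul_comm]
  exact (mul_le_mul_of_nonneg_left hbr hm.le).trans hle

lemma iterate_derivative_succ_mul_sub (ψ : ℝ[X]) (a : ℝ) (m : ℕ) :
    derivative^[m + 1] (ψ * (C a - X))
      = derivative^[m + 1] ψ * (C a - X) - ((m : ℝ[X]) + 1) * derivative^[m] ψ := by
  induction m with
  | zero =>
    simp [derivative_mul]
    ring
  | succ m ih =>
    rw [Function.iterate_succ_apply', ih, derivative_sub, derivative_mul, derivative_mul,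
      ← Function.iterate_succ_apply' derivative (m + 1) ψ,
      ← Function.iterate_succ_apply' derivative m ψ]
    simp
    ring

/-- The derivatives at `τ` of a product of linear factors with zeros within distance `H`. -/
lemma abs_eval_iterate_derivative_prod_le {x : ℕ → ℝ} {τ H : ℝ} (p : ℕ)
    (hx : ∀ l < p, |x l - τ| ≤ H) (hH : 0 ≤ H) (m : ℕ) (hm : m ≤ p) :
    |(derivative^[m] (∏ l ∈ Finset.range p, (C (x l) - X))).eval τ|
      ≤ (p + 1).factorial * H ^ (p - m) := by
  induction p generalizing m with
  | zero =>
    obtain rfl : m = 0 := by omega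
    simp
  | succ p ih =>
    have ih' := ih fun l hl => hx l (by omega)
    have hxp := hx p (by omega)
    have hdeg := natDegree_prod_C_sub_X_le x p
    rw [Finset.prod_range_succ]
    set ψ := ∏ l ∈ Finset.range p, (C (x l) - X)
    have hfac : ((p + 1 + 1).factorial : ℝ) = (p + 2) * (p + 1).factorial := by
      rw [Nat.factorial_succ]
      push_cast
      ring
    have hf0 : (0 : ℝ) < (p + 1).factorial := by positivity
    rw [hfac]
    cases m with
    | zero =>
      have h := ih' 0 (Nat.zero_le _)
      simp only [Function.iterate_zero, id, Nat.sub_zero, eval_mul, eval_sub, eval_C, eval_X,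
        abs_mul] at h ⊢
      calc |ψ.eval τ| * |x p - τ| ≤ ((p + 1).factorial * H ^ p) * H := by gcongr
        _ = 1 * (p + 1).factorial * H ^ (p + 1) := by ring
        _ ≤ (p + 2) * (p + 1).factorial * H ^ (p + 1) := by
          gcongr
          have : (0 : ℝ) ≤ p := Nat.cast_nonneg p
          linarith
    | succ m =>
      have h2 := ih' m (by omega)
      have h1 : |(derivative^[m + 1] ψ).eval τ| * |x p - τ| ≤ (p + 1).factorial * H ^ (p - m) := by
        rcases Nat.lt_or_ge m p with hmp | hmp
        · have := ih' (m + 1) hmp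
          calc _ ≤ ((p + 1).factorial * H ^ (p - (m + 1))) * H := by gcongr
            _ = _ := by
              rw [mul_assoc, ← pow_succ, show p - (m + 1) + 1 = p - m by omega]
        · rw [iterate_derivative_eq_zero (by omega), eval_zero, abs_zero, zero_mul]
          positivity
      rw [iterate_derivative_succ_mul_sub, eval_sub, eval_mul, eval_mul]
      have e1 : (((m : ℝ[X]) + 1).eval τ) = (m : ℝ) + 1 := by simp
      have e2 : (C (x p) - X).eval τ = x p - τ := by simp
      rw [e1, e2, show p + 1 - (m + 1) = p - m by omega]
      have hmp : (m : ℝ) ≤ p := by exact_mod_cast (by omega : m ≤ p)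
      calc |(derivative^[m + 1] ψ).eval τ * (x p - τ) - ((m : ℝ) + 1) * (derivative^[m] ψ).eval τ|
          ≤ |(derivative^[m + 1] ψ).eval τ| * |x p - τ|
            + ((m : ℝ) + 1) * |(derivative^[m] ψ).eval τ| := by
            refine (abs_sub _ _).trans ?_
            rw [abs_mul, abs_mul, abs_of_nonneg (by positivity : (0 : ℝ) ≤ (m : ℝ) + 1)]
        _ ≤ (p + 1).factorial * H ^ (p - m)
            + ((p : ℝ) + 1) * ((p + 1).factorial * H ^ (p - m)) := by gcongr
        _ = _ := by ring

/-- Local quasi-uniformity at degree `p`, with the constant already at least one. -/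
structure IsQuasiUniform (M : ℝ) (p n : ℕ) (k : ℕ → ℝ) : Prop where
  one_le : 1 ≤ M
  left : ∀ j, p ≤ j → j + 1 < n → width k j ≤ M * width k (j + 1)
  right : ∀ j, p ≤ j → j + 1 < n → width k (j + 1) ≤ M * width k j

lemma IsClamped.width_nonneg {p n : ℕ} {k : ℕ → ℝ} (hk : IsClamped p n k) (i : ℕ) :
    0 ≤ width k i := sub_nonneg.2 (hk.mono (Nat.le_succ i))

lemma IsQuasiUniform.sub_le_right {M : ℝ} {p n : ℕ} {k : ℕ → ℝ} (hk : IsClamped p n k)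
    (hM : IsQuasiUniform M p n k) {i : ℕ} (hpi : p ≤ i) (l : ℕ) :
    k (i + l) - k i ≤ l * M ^ l * width k i := by
  have hw : ∀ l, width k (i + l) ≤ M ^ l * width k i := by
    intro l
    induction l with
    | zero => simp
    | succ l ih =>
      rcases lt_or_ge (i + l + 1) n with h | h
      · have := hM.right (i + l) (by omega) h
        rw [pow_succ']
        calc _ ≤ M * width k (i + l) := this
          _ ≤ M * (M ^ l * width k i) := mul_le_mul_of_nonneg_left ih (by linarith [hM.one_le])
          _ = _ := by ring
      · have : width k (i + (l + 1)) = 0 := by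
          rw [width, hk.eq_one _ (by omega), hk.eq_one _ (by omega), sub_self]
        rw [this]
        exact mul_nonneg (pow_nonneg (by linarith [hM.one_le]) _) (hk.width_nonneg i)
  have h1 := hM.one_le
  have h0 := hk.width_nonneg i
  induction l with
  | zero => simp
  | succ l ih =>
    have e : k (i + (l + 1)) - k i = (k (i + l) - k i) + width k (i + l) := by
      rw [width, ← add_assoc]
      ring
    rw [e]
    calc _ ≤ l * M ^ l * width k i + M ^ l * width k i := add_le_add ih (hw l)
      _ = ((l : ℝ) + 1) * M ^ l * width k i := by ring
      _ ≤ ((l : ℝ) + 1) * M ^ (l + 1) * width k i := by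
        gcongr
        exact Nat.le_succ l
      _ = _ := by push_cast; ring

lemma IsQuasiUniform.sub_le_left {M : ℝ} {p n : ℕ} {k : ℕ → ℝ} (hk : IsClamped p n k)
    (hM : IsQuasiUniform M p n k) {i : ℕ} (hin : i < n) (l : ℕ) (hl : l ≤ i) :
    k i - k (i - l) ≤ l * M ^ l * width k i := by
  have h1 := hM.one_le
  have h0 := hk.width_nonneg i
  have hw : ∀ l ≤ i, width k (i - l) ≤ M ^ l * width k i := by
    intro l
    induction l with
    | zero => simp
    | succ l ih =>
      intro hl
      rcases le_or_gt p (i - (l + 1)) with h | h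
      · have := hM.left (i - (l + 1)) h (by omega)
        rw [show i - (l + 1) + 1 = i - l by omega] at this
        rw [pow_succ']
        calc _ ≤ M * width k (i - l) := this
          _ ≤ M * (M ^ l * width k i) := mul_le_mul_of_nonneg_left (ih (by omega)) (by linarith)
          _ = _ := by ring
      · have : width k (i - (l + 1)) = 0 := by
          rw [width, hk.eq_zero _ (by omega), hk.eq_zero _ (by omega), sub_self]
        rw [this]
        exact mul_nonneg (pow_nonneg (by linarith) _) h0
  induction l with
  | zero => simp
  | succ l ih =>
    have e : k i - k (i - (l + 1)) = (k i - k (i - l)) + width k (i - (l + 1)) := by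
      rw [width, show i - (l + 1) + 1 = i - l by omega]
      ring
    rw [e]
    calc _ ≤ l * M ^ l * width k i + M ^ (l + 1) * width k i :=
          add_le_add (ih (by omega)) (hw (l + 1) hl)
      _ ≤ l * M ^ (l + 1) * width k i + M ^ (l + 1) * width k i := by
        gcongr
        exact Nat.le_succ l
      _ = _ := by push_cast; ring

lemma IsQuasiUniform.abs_sub_le {M : ℝ} {p n : ℕ} {k : ℕ → ℝ} (hk : IsClamped p n k)
    (hM : IsQuasiUniform M p n k) {i : ℕ} (hpi : p ≤ i) (hin : i < n) {j : ℕ} (h1 : i ≤ j + p)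
    (h2 : j ≤ i + p) : |k j - k i| ≤ p * M ^ p * width k i := by
  have hM1 := hM.one_le
  have h0 := hk.width_nonneg i
  have key (l : ℕ) (hl : l ≤ p) : l * M ^ l * width k i ≤ p * M ^ p * width k i := by
    gcongr
  rcases le_total i j with h | h
  · rw [abs_of_nonneg (sub_nonneg.2 (hk.mono h))]
    have := hM.sub_le_right hk hpi (j - i)
    rw [show i + (j - i) = j by omega] at this
    exact this.trans (key _ (by omega))
  · rw [abs_sub_comm, abs_of_nonneg (sub_nonneg.2 (hk.mono h))]
    have := hM.sub_le_left hk hin (i - j) (by omega)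
    rw [show i - (i - j) = j by omega] at this
    exact this.trans (key _ (by omega))

/-- Local `L²` stability of the B-spline basis on locally quasi-uniform knots. The control point
`c j` is the pairing of the polynomial piece with `ψ_j`, taken at `k_i`; there the derivatives of
the piece are controlled by its `L²` norm, and those of `ψ_j` by the distances of its zeros from
`k_i`, which are at most a multiple of the width. -/
lemma exists_sq_coeff_mul_width_le (p : ℕ) (M : ℝ) : ∃ K : ℝ, 0 < K ∧
    ∀ (n : ℕ) (k : ℕ → ℝ), IsClamped p n k → IsQuasiUniform M p n k →
    ∀ i, p ≤ i → i < n → ∀ (c : ℕ → ℝ) (j : ℕ), j ≤ i → i ≤ j + p →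
      c j ^ 2 * width k i
        ≤ K * ∫ t in k i..k (i + 1), ((splinePoly k i p n c).eval t) ^ 2 := by
  obtain ⟨K₀, hK₀, hcoeff⟩ := exists_sq_coeff_le_integral p
  set R : ℝ := p * |M| ^ p
  set D : ℝ := ∑ r ∈ Finset.range (p + 1), (p + 1).factorial * R ^ r
  have hR : 0 ≤ R := by positivity
  have hD : 0 ≤ D := by positivity
  refine ⟨(D ^ 2 + 1) * K₀, by positivity, fun n k hk hM i hpi hin c j hji hij => ?_⟩
  have hMabs : |M| = M := abs_of_nonneg (by linarith [hM.one_le])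
  have hi := hk.lt_succ i hpi hin
  set h := width k i with hh
  have hpos : 0 < h := sub_pos.2 hi
  set s := splinePoly k i p n c with hs
  have hdeg : s.natDegree ≤ p := natDegree_splinePoly_le k i p n c
  set a : ℕ → ℝ := fun r => (taylor (k i) s).coeff r * h ^ r
  set I := ∫ v in (0 : ℝ)..1, (∑ l ∈ Finset.range (p + 1), a l * v ^ l) ^ 2 with hI
  have hI0 : 0 ≤ I := intervalIntegral.integral_nonneg zero_le_one fun v _ => sq_nonneg _
  have hint : ∫ t in k i..k (i + 1), (s.eval t) ^ 2 = h * I := by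
    have hsub := intervalIntegral.smul_integral_comp_add_mul (a := 0) (b := 1)
      (fun t => (s.eval t) ^ 2) h (k i)
    rw [mul_zero, add_zero, mul_one, show k i + h = k (i + 1) by rw [hh, width]; ring,
      smul_eq_mul] at hsub
    rw [← hsub, hI]
    congr 2
    ext v
    congr 1
    have ht := taylor_eval (k i) s (h * v)
    rw [add_comm, ← ht, eval_eq_sum_range' (n := p + 1) (by rw [natDegree_taylor]; omega)]
    refine Finset.sum_congr rfl fun r _ => ?_
    simp only [a, mul_pow]
    ring
  have hder (r : ℕ) : (derivative^[r] s).eval (k i) = r.factorial * (taylor (k i) s).coeff r := by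
    rw [taylor_coeff, ← factorial_smul_hasseDeriv]
    simp
  have hca : |c j| ≤ D * √(K₀ * I) := by
    rw [← pairing_splinePoly hk.mono hi hpi hin c (k i) hji hij, pairing, Finset.mul_sum,
      Finset.sum_mul]
    refine (Finset.abs_sum_le_sum_abs _ _).trans (Finset.sum_le_sum fun r hr => ?_)
    have hrp : r ≤ p := by have := Finset.mem_range.1 hr; omega
    have har : |a r| ≤ √(K₀ * I) := Real.abs_le_sqrt (hcoeff a r hrp)
    have hψ := abs_eval_iterate_derivative_prod_le (x := fun l => k (j + l + 1)) (τ := k i)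
      (H := R * h) p (fun l hl => by
        have := hM.abs_sub_le hk hpi hin (j := j + l + 1) (by omega) (by omega)
        simpa only [R, hMabs] using this) (by positivity) (p - r) (by omega)
    rw [show p - (p - r) = r by omega] at hψ
    rw [← hs, hder, dualPoly]
    have hfac : 1 / (p.factorial : ℝ) * r.factorial ≤ 1 := by
      rw [one_div_mul_eq_div, div_le_one (by positivity)]
      exact_mod_cast Nat.factorial_le hrp
    have hf0 : (0 : ℝ) ≤ 1 / (p.factorial : ℝ) * r.factorial := by positivity
    calc |1 / (p.factorial : ℝ) * ((-1) ^ (p - r) * (r.factorial * (taylor (k i) s).coeff r) *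
          (derivative^[p - r] (∏ l ∈ Finset.range p, (C (k (j + l + 1)) - X))).eval (k i))|
        = (1 / (p.factorial : ℝ) * r.factorial) * (|(taylor (k i) s).coeff r| *
          |(derivative^[p - r] (∏ l ∈ Finset.range p, (C (k (j + l + 1)) - X))).eval (k i)|) := by
          simp only [abs_mul, abs_pow, abs_neg, abs_one, one_pow, abs_div, Nat.abs_cast]
          ring
      _ ≤ 1 * (|(taylor (k i) s).coeff r| * ((p + 1).factorial * (R * h) ^ r)) := by gcongr
      _ = (p + 1).factorial * R ^ r * |a r| := by
          simp only [a, abs_mul, abs_pow, abs_of_pos hpos, mul_pow]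
          ring
      _ ≤ (p + 1).factorial * R ^ r * √(K₀ * I) := by gcongr
  rw [hint]
  have hsq : c j ^ 2 ≤ D ^ 2 * (K₀ * I) := by
    rw [← Real.sq_sqrt (by positivity : 0 ≤ K₀ * I), ← mul_pow, ← sq_abs]
    exact pow_le_pow_left₀ (abs_nonneg _) hca 2
  calc c j ^ 2 * h ≤ (D ^ 2 * (K₀ * I)) * h := by gcongr
    _ ≤ ((D ^ 2 + 1) * (K₀ * I)) * h := by gcongr; linarith
    _ = _ := by ring

/-! ### Weighted energy estimate for the `L²` projection -/

lemma integral_eq_sum_spans {p n : ℕ} {k : ℕ → ℝ} (hk : IsClamped p n k) {φ : ℝ → ℝ}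
    {ψ : ℕ → ℝ → ℝ} (hψ : ∀ i, p ≤ i → i < n → ContinuousOn (ψ i) (Icc (k i) (k (i + 1))))
    (hφ : ∀ i, p ≤ i → i < n → ∀ u, OnSpan k i u → φ u = ψ i u) :
    ∫ u in (0 : ℝ)..1, φ u = ∑ i ∈ Finset.Ico p n, ∫ u in k i..k (i + 1), ψ i u := by
  have hEq (i : ℕ) (hi : p ≤ i ∧ i < n) : EqOn (ψ i) φ (uIoo (k i) (k (i + 1))) := by
    intro u hu
    rw [uIoo_of_le (hk.mono (Nat.le_succ i))] at hu
    exact (hφ i hi.1 hi.2 u (Or.inl ⟨hu.1.le, hu.2⟩)).symm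
  have hsum := intervalIntegral.sum_integral_adjacent_intervals_Ico (f := φ)
    (μ := MeasureTheory.volume) (a := k) hk.lt.le (fun i hi =>
      ((hψ i hi.1 hi.2).intervalIntegrable_of_Icc (hk.mono (Nat.le_succ i))).congr_uIoo (hEq i hi))
  rw [hk.eq_zero p le_rfl, hk.eq_one n le_rfl] at hsum
  rw [← hsum]
  refine Finset.sum_congr rfl fun i hi => ?_
  rw [Finset.mem_Ico] at hi
  exact (intervalIntegral.integral_congr_uIoo (hEq i hi)).symm

/-- The control points as a function on `ℕ`, vanishing beyond the last one. -/
noncomputable def extendCoeff {n : ℕ} (P : Fin n → ℝ) (j : ℕ) : ℝ :=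
  if h : j < n then P ⟨j, h⟩ else 0

lemma spline_coe_eq_eval {p n : ℕ} {k : ℕ → ℝ} (hk : IsClamped p n k) {i : ℕ} {u : ℝ}
    (hu : OnSpan k i u) (c : ℕ → ℝ) :
    spline (p + 1) n k (fun j => c j) u = (splinePoly k i p n c).eval u := by
  rw [eval_splinePoly, spline, Fin.sum_univ_eq_sum_range (fun j => c j * basis k (p + 1 - 1) j u)]
  exact Finset.sum_congr rfl fun j _ => by rw [Nat.add_sub_cancel, basis_eq_eval_spanPoly hk hu]

lemma extendCoeff_coe {n : ℕ} (P : Fin n → ℝ) : (fun j : Fin n => extendCoeff P j) = P := by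
  ext j
  simp [extendCoeff]

lemma spline_eq_eval {p n : ℕ} {k : ℕ → ℝ} (hk : IsClamped p n k) {i : ℕ} {u : ℝ}
    (hu : OnSpan k i u) (P : Fin n → ℝ) :
    spline (p + 1) n k P u = (splinePoly k i p n (extendCoeff P)).eval u := by
  rw [← spline_coe_eq_eval hk hu, extendCoeff_coe]

lemma splinePoly_add_smul (k : ℕ → ℝ) (i p m : ℕ) (c d : ℕ → ℝ) (r u : ℝ) :
    (splinePoly k i p m (fun j => c j + r * d j)).eval u
      = (splinePoly k i p m c).eval u + r * (splinePoly k i p m d).eval u := by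
  simp only [eval_splinePoly, Finset.mul_sum, ← Finset.sum_add_distrib]
  exact Finset.sum_congr rfl fun j _ => by ring

lemma eq_zero_of_forall_quadratic_nonneg {B D : ℝ} (hD : 0 ≤ D)
    (h : ∀ r : ℝ, 0 ≤ -(2 * r * B) + r ^ 2 * D) : B = 0 := by
  have h1 := h (B / (D + 1))
  have hD1 : 0 < D + 1 := by linarith
  have e : -(2 * (B / (D + 1)) * B) + (B / (D + 1)) ^ 2 * D
      = -(B ^ 2 * (D + 2)) / (D + 1) ^ 2 := by
    field_simp
    ring
  rw [e, le_div_iff₀ (by positivity), zero_mul] at h1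
  have h2 : 0 ≤ B ^ 2 := sq_nonneg B
  have h3 : B ^ 2 = 0 := by nlinarith
  exact pow_eq_zero_iff (two_ne_zero) |>.1 h3

/-- The error of the best `L²` approximation is orthogonal to all splines. -/
lemma IsBestL2.orthogonal {p n : ℕ} {k : ℕ → ℝ} (hk : IsClamped p n k) {g : ℝ → ℝ}
    (hg : ContinuousOn g (Icc 0 1)) {P : Fin n → ℝ} (hP : IsBestL2 (p + 1) n k g P) (d : ℕ → ℝ) :
    ∑ i ∈ Finset.Ico p n, ∫ u in k i..k (i + 1),
      (g u - (splinePoly k i p n (extendCoeff P)).eval u) * (splinePoly k i p n d).eval u = 0 := by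
  have hgi (i : ℕ) : ContinuousOn g (Icc (k i) (k (i + 1))) :=
    hg.mono (Icc_subset_Icc (hk.nonneg _) (hk.le_one _))
  have hle (i : ℕ) : k i ≤ k (i + 1) := hk.mono (Nat.le_succ i)
  set c := extendCoeff P
  have hs (i : ℕ) (d : ℕ → ℝ) :
      ContinuousOn (fun u => (splinePoly k i p n d).eval u) (Icc (k i) (k (i + 1))) :=
    Polynomial.continuousOn _
  have henergy (d : ℕ → ℝ) : ∫ u in (0 : ℝ)..1, (g u - spline (p + 1) n k (fun j => d j) u) ^ 2
      = ∑ i ∈ Finset.Ico p n, ∫ u in k i..k (i + 1),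
        (g u - (splinePoly k i p n d).eval u) ^ 2 :=
    integral_eq_sum_spans hk (fun i _ _ => ((hgi i).sub (hs i d)).pow 2)
      (fun i _ _ u hu => by rw [spline_coe_eq_eval hk hu])
  refine eq_zero_of_forall_quadratic_nonneg
    (D := ∑ i ∈ Finset.Ico p n, ∫ u in k i..k (i + 1), ((splinePoly k i p n d).eval u) ^ 2)
    (Finset.sum_nonneg fun i _ => intervalIntegral.integral_nonneg (hle i) fun u _ => sq_nonneg _)
    fun r => ?_
  have h0 := henergy c
  rw [show (fun j : Fin n => c j) = P from extendCoeff_coe P] at h0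
  have h := h0.symm.trans_le ((hP _).trans_eq (henergy fun j => c j + r * d j))
  have hexp : ∑ i ∈ Finset.Ico p n, ∫ u in k i..k (i + 1),
        (g u - (splinePoly k i p n (fun j => c j + r * d j)).eval u) ^ 2
      = ∑ i ∈ Finset.Ico p n, (∫ u in k i..k (i + 1), (g u - (splinePoly k i p n c).eval u) ^ 2)
        + (-(2 * r * ∑ i ∈ Finset.Ico p n, ∫ u in k i..k (i + 1),
            (g u - (splinePoly k i p n c).eval u) * (splinePoly k i p n d).eval u)
        + r ^ 2 * ∑ i ∈ Finset.Ico p n, ∫ u in k i..k (i + 1),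
            ((splinePoly k i p n d).eval u) ^ 2) := by
    rw [Finset.mul_sum, Finset.mul_sum, ← Finset.sum_neg_distrib, ← Finset.sum_add_distrib,
      ← Finset.sum_add_distrib]
    refine Finset.sum_congr rfl fun i _ => ?_
    have i1 : IntervalIntegrable (fun u => (g u - (splinePoly k i p n c).eval u) ^ 2)
        MeasureTheory.volume (k i) (k (i + 1)) :=
      (((hgi i).sub (hs i c)).pow 2).intervalIntegrable_of_Icc (hle i)
    have i2 : IntervalIntegrable (fun u => -(2 * r * ((g u - (splinePoly k i p n c).eval u)
        * (splinePoly k i p n d).eval u))) MeasureTheory.volume (k i) (k (i + 1)) :=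
      ((((hgi i).sub (hs i c)).mul (hs i d)).intervalIntegrable_of_Icc (hle i)).const_mul (2 * r)
        |>.neg
    have i3 : IntervalIntegrable (fun u => r ^ 2 * ((splinePoly k i p n d).eval u) ^ 2)
        MeasureTheory.volume (k i) (k (i + 1)) :=
      (((hs i d).pow 2).intervalIntegrable_of_Icc (hle i)).const_mul _
    rw [← intervalIntegral.integral_const_mul, ← intervalIntegral.integral_const_mul,
      ← intervalIntegral.integral_neg,
      ← intervalIntegral.integral_add i2 i3, ← intervalIntegral.integral_add i1 (i2.add i3)]
    refine intervalIntegral.integral_congr fun u _ => ?_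
    simp only [splinePoly_add_smul]
    ring
  rw [hexp] at h
  linarith

/-- Weighted energy estimate: if a spline is orthogonal, up to the data `e`, to all splines, then
its energy in a slowly varying weight is controlled by that of the data. The test spline carries
the weight on its control points; by local stability it differs little from the weight times the
given spline. -/
lemma weighted_energy_le {p n : ℕ} {k : ℕ → ℝ} (hk : IsClamped p n k) {K ε : ℝ} (hK : 0 < K)
    (hε : 0 ≤ ε) (hεK : 8 * ε ^ 2 * K ≤ 1)
    {c : ℕ → ℝ} (hstab : ∀ i, p ≤ i → i < n → ∀ j, j ≤ i → i ≤ j + p → c j ^ 2 * width k i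
        ≤ K * ∫ t in k i..k (i + 1), ((splinePoly k i p n c).eval t) ^ 2)
    {e : ℕ → ℝ → ℝ} (he : ∀ i, p ≤ i → i < n → ContinuousOn (e i) (Icc (k i) (k (i + 1))))
    (horth : ∀ d : ℕ → ℝ, ∑ i ∈ Finset.Ico p n, ∫ u in k i..k (i + 1),
      (e i u - (splinePoly k i p n c).eval u) * (splinePoly k i p n d).eval u = 0)
    {ω : ℕ → ℝ} (hω0 : ∀ i, 0 ≤ ω i)
    (hω : ∀ i, p ≤ i → i < n → ∀ j, j ≤ i → i ≤ j + p → |ω j - ω i| ≤ ε * ω i) :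
    ∑ i ∈ Finset.Ico p n, ω i * ∫ u in k i..k (i + 1), ((splinePoly k i p n c).eval u) ^ 2
      ≤ 8 * ∑ i ∈ Finset.Ico p n, ω i * ∫ u in k i..k (i + 1), (e i u) ^ 2 := by
  have hle (i : ℕ) : k i ≤ k (i + 1) := hk.mono (Nat.le_succ i)
  have hs (i : ℕ) (d : ℕ → ℝ) :
      ContinuousOn (fun u => (splinePoly k i p n d).eval u) (Icc (k i) (k (i + 1))) :=
    Polynomial.continuousOn _
  have hspan : ∀ i ∈ Finset.Ico p n,
      ω i * ((1 / 4) * (∫ u in k i..k (i + 1), ((splinePoly k i p n c).eval u) ^ 2)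
        - 2 * ∫ u in k i..k (i + 1), (e i u) ^ 2)
      ≤ -∫ u in k i..k (i + 1), (e i u - (splinePoly k i p n c).eval u) *
          (splinePoly k i p n (fun j => ω j * c j)).eval u := by
    intro i hi
    rw [Finset.mem_Ico] at hi
    have hpos : 0 < width k i := sub_pos.2 (hk.lt_succ i hi.1 hi.2)
    set S := ∫ u in k i..k (i + 1), ((splinePoly k i p n c).eval u) ^ 2 with hS
    have hS0 : 0 ≤ S := intervalIntegral.integral_nonneg (hle i) fun u _ => sq_nonneg _
    -- a bound for the active control points, multiplied by the oscillation of the weight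
    set b := ε * √(K * S / width k i) with hb
    have hb2 : b ^ 2 * width k i = ε ^ 2 * (K * S) := by
      rw [hb, mul_pow, Real.sq_sqrt (by positivity)]
      field_simp
    have hr : ∀ u ∈ Icc (k i) (k (i + 1)),
        |(splinePoly k i p n (fun j => ω j * c j)).eval u
          - ω i * (splinePoly k i p n c).eval u| ≤ ω i * b := by
      intro u hu
      have e1 : (splinePoly k i p n (fun j => ω j * c j)).eval u
          - ω i * (splinePoly k i p n c).eval u
          = ∑ j ∈ Finset.range n, ((ω j - ω i) * c j) * (spanPoly k i p j).eval u := by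
        rw [eval_splinePoly, eval_splinePoly, Finset.mul_sum, ← Finset.sum_sub_distrib]
        exact Finset.sum_congr rfl fun j _ => by ring
      rw [e1]
      refine abs_sum_mul_spanPoly_le hk.mono (hk.lt_succ i hi.1 hi.2) hi.1 hi.2 hu
        fun j hji hij => ?_
      have hc : |c j| ≤ √(K * S / width k i) := by
        refine Real.abs_le_sqrt ?_
        rw [le_div_iff₀ hpos]
        exact hstab i hi.1 hi.2 j hji hij
      rw [abs_mul]
      calc |ω j - ω i| * |c j| ≤ (ε * ω i) * √(K * S / width k i) :=
            mul_le_mul (hω i hi.1 hi.2 j hji hij) hc (abs_nonneg _)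
              (mul_nonneg hε (hω0 i))
        _ = ω i * b := by rw [hb]; ring
    have i1 : IntervalIntegrable (fun u => ((splinePoly k i p n c).eval u) ^ 2)
        MeasureTheory.volume (k i) (k (i + 1)) := ((hs i c).pow 2).intervalIntegrable_of_Icc (hle i)
    have i2 : IntervalIntegrable (fun u => (e i u) ^ 2) MeasureTheory.volume (k i) (k (i + 1)) :=
      ((he i hi.1 hi.2).pow 2).intervalIntegrable_of_Icc (hle i)
    have i3 : IntervalIntegrable (fun u => -((e i u - (splinePoly k i p n c).eval u) *
        (splinePoly k i p n (fun j => ω j * c j)).eval u)) MeasureTheory.volume (k i) (k (i + 1)) :=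
      (((he i hi.1 hi.2).sub (hs i c)).mul
        (hs i (fun j => ω j * c j))).neg.intervalIntegrable_of_Icc (hle i)
    have i4 : IntervalIntegrable (fun _ : ℝ => 2 * b ^ 2) MeasureTheory.volume (k i) (k (i + 1)) :=
      intervalIntegrable_const
    have hmono := intervalIntegral.integral_mono_on (hle i)
      ((((i1.const_mul (1 / 2)).sub (i2.const_mul 2)).sub i4).const_mul (ω i)) i3
      fun u hu => by
        have hru := hr u hu
        set s := (splinePoly k i p n c).eval u
        set t := (splinePoly k i p n (fun j => ω j * c j)).eval u
        set y := e i u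
        -- Young's inequality in `(s - y) t = ω (s² - s y) + (s - y) (t - ω s)`
        have h1 : |(s - y) * (t - ω i * s)| ≤ |s - y| * (ω i * b) := by
          rw [abs_mul]
          exact mul_le_mul_of_nonneg_left hru (abs_nonneg _)
        have h2 := (abs_le.1 h1).1
        have h3 : |s - y| * (ω i * b) ≤ ω i * (s ^ 2 / 4 + y ^ 2 / 4 * 3 + 4 / 3 * b ^ 2) := by
          have h4 : |s - y| * b ≤ s ^ 2 / 4 + y ^ 2 / 4 * 3 + 4 / 3 * b ^ 2 := by
            have h5 : (s - y) ^ 2 = |s - y| ^ 2 := (sq_abs _).symm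
            nlinarith [sq_nonneg (|s - y| * (3 / 8) - b), sq_nonneg (s + 3 * y),
              sq_nonneg (|s - y| - (8 / 3) * b)]
          calc |s - y| * (ω i * b) = ω i * (|s - y| * b) := by ring
            _ ≤ _ := mul_le_mul_of_nonneg_left h4 (hω0 i)
        have h6 : ω i * (s * y) ≤ ω i * (s ^ 2 / 4 + y ^ 2) :=
          mul_le_mul_of_nonneg_left (by nlinarith [sq_nonneg (s / 2 - y)]) (hω0 i)
        have h7 : 0 ≤ ω i * b ^ 2 := mul_nonneg (hω0 i) (sq_nonneg _)
        have h8 : 0 ≤ ω i * y ^ 2 := mul_nonneg (hω0 i) (sq_nonneg _)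
        nlinarith
    rw [intervalIntegral.integral_neg, intervalIntegral.integral_const_mul,
      intervalIntegral.integral_sub ((i1.const_mul (1 / 2)).sub (i2.const_mul 2)) i4,
      intervalIntegral.integral_sub (i1.const_mul (1 / 2)) (i2.const_mul 2),
      intervalIntegral.integral_const_mul, intervalIntegral.integral_const_mul,
      intervalIntegral.integral_const, smul_eq_mul] at hmono
    refine le_trans (mul_le_mul_of_nonneg_left ?_ (hω0 i)) hmono
    have h9 : (k (i + 1) - k i) * (2 * b ^ 2) = 2 * (ε ^ 2 * (K * S)) := by
      rw [← hb2, width]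
      ring
    have h10 : 8 * ε ^ 2 * K * S ≤ 1 * S := mul_le_mul_of_nonneg_right hεK hS0
    rw [h9]
    linarith
  have hsum := Finset.sum_le_sum hspan
  rw [Finset.sum_neg_distrib, horth, neg_zero] at hsum
  have e2 : ∑ i ∈ Finset.Ico p n,
      ω i * ((1 / 4) * (∫ u in k i..k (i + 1), ((splinePoly k i p n c).eval u) ^ 2)
        - 2 * ∫ u in k i..k (i + 1), (e i u) ^ 2)
      = (1 / 4) * ∑ i ∈ Finset.Ico p n,
          ω i * (∫ u in k i..k (i + 1), ((splinePoly k i p n c).eval u) ^ 2)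
        - 2 * ∑ i ∈ Finset.Ico p n, ω i * ∫ u in k i..k (i + 1), (e i u) ^ 2 := by
    rw [Finset.mul_sum, Finset.mul_sum, ← Finset.sum_sub_distrib]
    exact Finset.sum_congr rfl fun i _ => by ring
  rw [e2] at hsum
  linarith

/-- Pointwise consequence of the weighted energy estimate, for a weight that is `1` at the span
under consideration. -/
lemma sq_eval_splinePoly_le {p n : ℕ} {k : ℕ → ℝ} (hk : IsClamped p n k) {K ε : ℝ} (hK : 0 < K)
    (hε : 0 ≤ ε) (hεK : 8 * ε ^ 2 * K ≤ 1)
    {c : ℕ → ℝ} (hstab : ∀ i, p ≤ i → i < n → ∀ j, j ≤ i → i ≤ j + p → c j ^ 2 * width k i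
        ≤ K * ∫ t in k i..k (i + 1), ((splinePoly k i p n c).eval t) ^ 2)
    {e : ℕ → ℝ → ℝ} (he : ∀ i, p ≤ i → i < n → ContinuousOn (e i) (Icc (k i) (k (i + 1))))
    (horth : ∀ d : ℕ → ℝ, ∑ i ∈ Finset.Ico p n, ∫ u in k i..k (i + 1),
      (e i u - (splinePoly k i p n c).eval u) * (splinePoly k i p n d).eval u = 0)
    {ω : ℕ → ℝ} (hω0 : ∀ i, 0 ≤ ω i)
    (hω : ∀ i, p ≤ i → i < n → ∀ j, j ≤ i → i ≤ j + p → |ω j - ω i| ≤ ε * ω i)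
    {E : ℕ → ℝ} (hE : ∀ i, p ≤ i → i < n → ∀ u ∈ Icc (k i) (k (i + 1)), |e i u| ≤ E i)
    {m : ℕ} (hpm : p ≤ m) (hmn : m < n) (hωm : ω m = 1) {u : ℝ}
    (hu : u ∈ Icc (k m) (k (m + 1))) :
    ((splinePoly k m p n c).eval u) ^ 2 * width k m
      ≤ 8 * K * ∑ i ∈ Finset.Ico p n, ω i * (E i ^ 2 * width k i) := by
  have hle (i : ℕ) : k i ≤ k (i + 1) := hk.mono (Nat.le_succ i)
  have hpos : 0 < width k m := sub_pos.2 (hk.lt_succ m hpm hmn)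
  set S := fun i => ∫ u in k i..k (i + 1), ((splinePoly k i p n c).eval u) ^ 2 with hS
  have hS0 (i : ℕ) : 0 ≤ S i := intervalIntegral.integral_nonneg (hle i) fun u _ => sq_nonneg _
  have h1 : |(splinePoly k m p n c).eval u| ≤ √(K * S m / width k m) := by
    rw [eval_splinePoly]
    refine abs_sum_mul_spanPoly_le hk.mono (hk.lt_succ m hpm hmn) hpm hmn hu fun j hji hij => ?_
    refine Real.abs_le_sqrt ?_
    rw [le_div_iff₀ hpos]
    exact hstab m hpm hmn j hji hij
  have h2 : ((splinePoly k m p n c).eval u) ^ 2 * width k m ≤ K * S m := by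
    rw [← le_div_iff₀ hpos, ← Real.sq_sqrt (by have := hS0 m; positivity : 0 ≤ K * S m / width k m),
      ← sq_abs]
    exact pow_le_pow_left₀ (abs_nonneg _) h1 2
  have h3 : S m ≤ ∑ i ∈ Finset.Ico p n, ω i * S i := by
    calc S m = ω m * S m := by rw [hωm, one_mul]
      _ ≤ _ := Finset.single_le_sum (f := fun i => ω i * S i)
        (fun i _ => mul_nonneg (hω0 i) (hS0 i)) (Finset.mem_Ico.2 ⟨hpm, hmn⟩)
  have h4 := weighted_energy_le hk hK hε hεK hstab he horth hω0 hω
  have h5 : ∑ i ∈ Finset.Ico p n, ω i * ∫ u in k i..k (i + 1), (e i u) ^ 2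
      ≤ ∑ i ∈ Finset.Ico p n, ω i * (E i ^ 2 * width k i) := by
    refine Finset.sum_le_sum fun i hi => mul_le_mul_of_nonneg_left ?_ (hω0 i)
    rw [Finset.mem_Ico] at hi
    have h6 := intervalIntegral.integral_mono_on (hle i)
      (((he i hi.1 hi.2).pow 2).intervalIntegrable_of_Icc (μ := MeasureTheory.volume) (hle i))
      (intervalIntegrable_const (c := E i ^ 2)) fun u hu => by
        rw [Pi.pow_apply, ← sq_abs]
        exact pow_le_pow_left₀ (abs_nonneg _) (hE i hi.1 hi.2 u hu) 2
    rw [intervalIntegral.integral_const, smul_eq_mul] at h6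
    rw [mul_comm (E i ^ 2)]
    exact h6
  calc _ ≤ K * S m := h2
    _ ≤ K * (8 * ∑ i ∈ Finset.Ico p n, ω i * (E i ^ 2 * width k i)) := by
      refine mul_le_mul_of_nonneg_left ?_ hK.le
      linarith
    _ = _ := by ring

/-! ### Knots that equidistribute a density -/

/-- The knots divide the integral of `F` over `[0,1]` evenly among the `n - p` spans. -/
def Equidistributes (F : ℝ → ℝ) (p n : ℕ) (k : ℕ → ℝ) : Prop :=
  ∀ i, p ≤ i → i < n →
    ∫ t in k i..k (i + 1), F t = (∫ t in (0 : ℝ)..1, F t) / ((n : ℝ) - p)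

/-- A nonnegative density on `[0,1]`, bounded by `Φ`, whose `q`-th power is `L`-Lipschitz. -/
structure IsDensity (q : ℕ) (L Φ : ℝ) (F : ℝ → ℝ) : Prop where
  continuousOn : ContinuousOn F (Icc 0 1)
  nonneg : ∀ t, 0 ≤ F t
  le : ∀ t ∈ Icc (0 : ℝ) 1, F t ≤ Φ
  lipschitz : ∀ x ∈ Icc (0 : ℝ) 1, ∀ y ∈ Icc (0 : ℝ) 1, |F x ^ q - F y ^ q| ≤ L * |x - y|
  pos : 0 < L

section Density

variable {q p n : ℕ} {L Φ : ℝ} {F : ℝ → ℝ} {k : ℕ → ℝ}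

lemma IsDensity.intervalIntegrable (hF : IsDensity q L Φ F) {x y : ℝ} (hx : 0 ≤ x) (hxy : x ≤ y)
    (hy : y ≤ 1) : IntervalIntegrable F MeasureTheory.volume x y :=
  (hF.continuousOn.mono (Icc_subset_Icc hx hy)).intervalIntegrable_of_Icc hxy

lemma IsDensity.integral_mono (hF : IsDensity q L Φ F) {x y x' y' : ℝ} (hx : 0 ≤ x) (hxx : x ≤ x')
    (hxy : x' ≤ y') (hyy : y' ≤ y) (hy : y ≤ 1) : ∫ t in x'..y', F t ≤ ∫ t in x..y, F t :=
  intervalIntegral.integral_mono_interval hxx hxy hyy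
    (Filter.Eventually.of_forall fun t => hF.nonneg t)
    (hF.intervalIntegrable hx (hxx.trans (hxy.trans hyy)) hy)

/-- A large value of the density carries mass: the density stays above half of its value `F t`
within distance `F t ^ q / (2L)`. -/
lemma IsDensity.mul_min_le_integral (hF : IsDensity q L Φ F) (hq : q ≠ 0) {x y t : ℝ} (hx : 0 ≤ x)
    (hy : y ≤ 1) (ht : t ∈ Icc x y) :
    F t * min (y - x) (F t ^ q / (2 * L)) ≤ 2 * ∫ s in x..y, F s := by
  have hL := hF.pos
  have hFt := hF.nonneg t
  set r := F t ^ q / (2 * L) with hr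
  have hr0 : 0 ≤ r := by positivity
  have h1 : max x (t - r) ≤ t := max_le ht.1 (by linarith)
  have h2 : t ≤ min y (t + r) := le_min ht.2 (by linarith)
  have ht01 : t ∈ Icc (0 : ℝ) 1 := ⟨hx.trans ht.1, ht.2.trans hy⟩
  have hlow : ∀ s ∈ Icc (max x (t - r)) (min y (t + r)), F t / 2 ≤ F s := by
    intro s hs
    have hs1 := (le_max_left _ _).trans hs.1
    have hs2 := (le_max_right _ _).trans hs.1
    have hs3 := hs.2.trans (min_le_left _ _)
    have hs4 := hs.2.trans (min_le_right _ _)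
    have hst : |t - s| ≤ r := abs_le.2 ⟨by linarith, by linarith⟩
    have h3 := (le_abs_self _).trans
      (hF.lipschitz t ht01 s ⟨hx.trans hs1, hs3.trans hy⟩)
    have h4 : L * |t - s| ≤ F t ^ q / 2 := by
      calc L * |t - s| ≤ L * r := by gcongr
        _ = F t ^ q / 2 := by rw [hr]; field_simp
    have h5 : (F t / 2) ^ q ≤ F t ^ q / 2 := by
      rw [div_pow]
      gcongr
      exact le_self_pow₀ one_le_two hq
    exact le_of_pow_le_pow_left₀ hq (hF.nonneg s) (by linarith)
  have hlen : min (y - x) r ≤ min y (t + r) - max x (t - r) := by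
    have a1 := min_le_left (y - x) r
    have a2 := min_le_right (y - x) r
    rcases le_total y (t + r) with h | h <;> rcases le_total x (t - r) with h' | h' <;>
      simp only [min_eq_left h, min_eq_right h, max_eq_left h', max_eq_right h'] <;>
      linarith [ht.1, ht.2]
  have h6 := hF.integral_mono hx (le_max_left x (t - r)) (h1.trans h2) (min_le_left y (t + r)) hy
  have h7 := intervalIntegral.integral_mono_on (h1.trans h2)
    (intervalIntegrable_const (c := F t / 2))
    (hF.intervalIntegrable (hx.trans (le_max_left _ _)) (h1.trans h2)
      ((min_le_left _ _).trans hy)) hlow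
  rw [intervalIntegral.integral_const, smul_eq_mul] at h7
  have h8 := mul_le_mul_of_nonneg_right hlen (by positivity : 0 ≤ F t / 2)
  linarith

lemma Equidistributes.integral_le (hk : IsClamped p n k) (hF : IsDensity q L Φ F)
    (hE : Equidistributes F p n k) {i l : ℕ} (hil : i ≤ l) :
    ∫ t in k i..k l, F t ≤ (l - i : ℝ) * ((∫ t in (0 : ℝ)..1, F t) / ((n : ℝ) - p)) := by
  have hS : 0 ≤ ∫ t in (0 : ℝ)..1, F t :=
    intervalIntegral.integral_nonneg zero_le_one fun t _ => hF.nonneg t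
  have hpn : (p : ℝ) < n := by exact_mod_cast hk.lt
  have hstep (i : ℕ) : ∫ t in k i..k (i + 1), F t ≤ (∫ t in (0 : ℝ)..1, F t) / ((n : ℝ) - p) := by
    have h0 : 0 ≤ (∫ t in (0 : ℝ)..1, F t) / ((n : ℝ) - p) := div_nonneg hS (by linarith)
    rcases lt_or_ge i p with h | h
    · rw [hk.eq_zero i h.le, hk.eq_zero (i + 1) h, intervalIntegral.integral_same]
      exact h0
    rcases lt_or_ge i n with h' | h'
    · exact (hE i h h').le
    · rw [hk.eq_one i h', hk.eq_one (i + 1) (by omega), intervalIntegral.integral_same]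
      exact h0
  induction l, hil using Nat.le_induction with
  | base => simp
  | succ l hil ih =>
    rw [← intervalIntegral.integral_add_adjacent_intervals
      (hF.intervalIntegrable (hk.nonneg i) (hk.mono hil) (hk.le_one l))
      (hF.intervalIntegrable (hk.nonneg l) (hk.mono (Nat.le_succ l)) (hk.le_one (l + 1)))]
    have := hstep l
    push_cast
    linarith

lemma IsDensity.exists_max (hF : IsDensity q L Φ F) (hk : IsClamped p n k) {i l : ℕ} (hil : i ≤ l) :
    ∃ t ∈ Icc (k i) (k l), ∀ s ∈ Icc (k i) (k l), F s ≤ F t :=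
  isCompact_Icc.exists_isMaxOn (nonempty_Icc.2 (hk.mono hil))
    (hF.continuousOn.mono (Icc_subset_Icc (hk.nonneg i) (hk.le_one l)))

/-- The mass of `F^{p+1}` near a span is at most `m^p` times that of `F`, with `m` the maximum. -/
lemma Equidistributes.integral_pow_le (hk : IsClamped p n k) (hF : IsDensity q L Φ F)
    (hE : Equidistributes F p n k) {i : ℕ} (hpi : p ≤ i) {m : ℝ}
    (hm : ∀ s ∈ Icc (k (i - p)) (k (i + 1)), F s ≤ m) :
    ∫ t in k (i - p)..k (i + 1), F t ^ (p + 1)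
      ≤ m ^ p * ((p + 1) * ((∫ t in (0 : ℝ)..1, F t) / ((n : ℝ) - p))) := by
  have hle : k (i - p) ≤ k (i + 1) := hk.mono (by omega)
  have h1 := hE.integral_le hk hF (show i - p ≤ i + 1 by omega)
  have e : ((i + 1 : ℕ) : ℝ) - ((i - p : ℕ) : ℝ) = p + 1 := by
    rw [Nat.cast_sub hpi]
    push_cast
    ring
  rw [e] at h1
  have hint := hF.intervalIntegrable (hk.nonneg (i - p)) hle (hk.le_one (i + 1))
  have h2 := intervalIntegral.integral_mono_on hle
    (((hF.continuousOn.mono (Icc_subset_Icc (hk.nonneg (i - p)) (hk.le_one (i + 1)))).pow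
      (p + 1)).intervalIntegrable_of_Icc hle) (hint.const_mul (m ^ p)) fun s hs => by
        simp only [Pi.pow_apply]
        rw [pow_succ]
        have := hF.nonneg s
        have := hm s hs
        gcongr
  rw [intervalIntegral.integral_const_mul] at h2
  have hm0 : 0 ≤ m := (hF.nonneg _).trans (hm _ (left_mem_Icc.2 hle))
  exact h2.trans (mul_le_mul_of_nonneg_left h1 (pow_nonneg hm0 _))

/-- The number of spans between the `i`-th and the `j`-th. -/
def spanDist (i j : ℕ) : ℕ := (i - j) + (j - i)

/-- Comparison of spans, for `p ≥ 1`: with `m` and `y` the maxima of the density near the `i`-th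
and on the `j`-th span, `N m^{2p} h_i y` grows at most linearly in the distance. Either
`N m h_i = O(1)`, or `N m^{p+2} = O(1)`, and then `y ≤ 2m` unless the rise of the density from `m`
to `y` costs `N y^{p+2}` spans. -/
lemma Equidistributes.mul_pow_mul_width_le (hp : 1 ≤ p) (hk : IsClamped p n k)
    (hF : IsDensity (p + 1) L Φ F) (hE : Equidistributes F p n k) {i j : ℕ} (hpi : p ≤ i)
    {t s : ℝ} (ht : t ∈ Icc (k (i - p)) (k (i + 1))) (hs : s ∈ Icc (k j) (k (j + 1))) :
    ((n : ℝ) - p) * (F t ^ (2 * p) * width k i * F s)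
      ≤ (2 * Φ ^ (2 * p) + 8 * L * Φ ^ (p - 1)) * (∫ t in (0 : ℝ)..1, F t) * (p + 1)
        * (1 + spanDist i j) := by
  have hL := hF.pos
  have hpn : (p : ℝ) < n := by exact_mod_cast hk.lt
  set N := (n : ℝ) - p with hN
  have hN0 : 0 < N := by rw [hN]; linarith
  set S := ∫ t in (0 : ℝ)..1, F t with hS
  have hS0 : 0 ≤ S := intervalIntegral.integral_nonneg zero_le_one fun t _ => hF.nonneg t
  have ht01 : t ∈ Icc (0 : ℝ) 1 := ⟨(hk.nonneg _).trans ht.1, ht.2.trans (hk.le_one _)⟩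
  have hs01 : s ∈ Icc (0 : ℝ) 1 := ⟨(hk.nonneg _).trans hs.1, hs.2.trans (hk.le_one _)⟩
  have hm0 := hF.nonneg t
  have hy0 := hF.nonneg s
  have hmΦ := hF.le t ht01
  have hyΦ := hF.le s hs01
  have hΦ0 : 0 ≤ Φ := hm0.trans hmΦ
  set m := F t
  set y := F s
  set d := (spanDist i j : ℝ) with hd
  have hd0 : 0 ≤ d := Nat.cast_nonneg _
  have hw0 := hk.width_nonneg i
  have hwW : width k i ≤ k (i + 1) - k (i - p) := by
    have : k (i - p) ≤ k i := hk.mono (Nat.sub_le _ _)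
    rw [width]
    linarith
  have hw1 : width k i ≤ 1 := by
    have := hk.nonneg i
    have := hk.le_one (i + 1)
    rw [width]
    linarith
  have hmass : N * (m * min (k (i + 1) - k (i - p)) (m ^ (p + 1) / (2 * L)))
      ≤ 2 * (S * (p + 1)) := by
    have h1 := hF.mul_min_le_integral (Nat.succ_ne_zero p) (hk.nonneg (i - p))
      (hk.le_one (i + 1)) ht
    have h2 := hE.integral_le hk hF (show i - p ≤ i + 1 by omega)
    rw [Nat.cast_sub hpi] at h2
    push_cast at h2
    have h3 : N * (2 * (((i : ℝ) + 1 - (i - p)) * (S / N))) = 2 * (S * (p + 1)) := by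
      field_simp
      ring
    rw [← h3]
    refine mul_le_mul_of_nonneg_left ?_ hN0.le
    linarith
  have hA0 : 0 ≤ 2 * Φ ^ (2 * p) * S * (p + 1) := by positivity
  have hB0 : 0 ≤ 8 * L * Φ ^ (p - 1) * S * (p + 1) := by positivity
  rcases le_total (k (i + 1) - k (i - p)) (m ^ (p + 1) / (2 * L)) with hcase | hcase
  · rw [min_eq_left hcase] at hmass
    have h1 : N * (m * width k i) ≤ 2 * (S * (p + 1)) := by
      refine le_trans ?_ hmass
      gcongr
    calc N * (m ^ (2 * p) * width k i * y)
        = (m ^ (2 * p - 1) * y) * (N * (m * width k i)) := by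
          rw [show 2 * p = 2 * p - 1 + 1 by omega, pow_succ, Nat.add_sub_cancel]
          ring
      _ ≤ (Φ ^ (2 * p - 1) * Φ) * (2 * (S * (p + 1))) := by gcongr
      _ = 2 * Φ ^ (2 * p) * S * (p + 1) := by
          rw [← pow_succ, show 2 * p - 1 + 1 = 2 * p by omega]
          ring
      _ ≤ (2 * Φ ^ (2 * p) * S * (p + 1) + 8 * L * Φ ^ (p - 1) * S * (p + 1)) * (1 + d) := by
          nlinarith
      _ = _ := by ring
  · rw [min_eq_right hcase] at hmass
    have hmN : N * m ^ (p + 2) ≤ 4 * L * (S * (p + 1)) := by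
      have e : N * (m * (m ^ (p + 1) / (2 * L))) = N * m ^ (p + 2) / (2 * L) := by
        rw [pow_succ m (p + 1)]
        ring
      rw [e, div_le_iff₀ (by positivity)] at hmass
      linarith
    have hkey : N * (m ^ (p + 1) * y) ≤ 8 * L * (S * (p + 1)) * (1 + d) := by
      rcases le_or_gt y (2 * m) with hym | hym
      · calc N * (m ^ (p + 1) * y) ≤ N * (m ^ (p + 1) * (2 * m)) := by gcongr
          _ = 2 * (N * m ^ (p + 2)) := by ring
          _ ≤ 2 * (4 * L * (S * (p + 1))) := by gcongr
          _ = 8 * L * (S * (p + 1)) * 1 := by ring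
          _ ≤ 8 * L * (S * (p + 1)) * (1 + d) := by gcongr; linarith
      · -- the density rises from `m` to `y`, so the points are at distance `y^{p+1} / (2L)`
        have hdist : y ^ (p + 1) / (2 * L) ≤ |s - t| := by
          have h1 := (le_abs_self _).trans (hF.lipschitz s hs01 t ht01)
          have h2 : m ^ (p + 1) ≤ y ^ (p + 1) / 2 := by
            calc m ^ (p + 1) ≤ (y / 2) ^ (p + 1) := by gcongr; linarith
              _ = y ^ (p + 1) / 2 ^ (p + 1) := div_pow _ _ _
              _ ≤ y ^ (p + 1) / 2 := by
                gcongr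
                exact le_self_pow₀ one_le_two (Nat.succ_ne_zero p)
          rw [div_le_iff₀ (by positivity)]
          linarith
        have hJ : s ∈ Icc (min s t) (max s t) := ⟨min_le_left _ _, le_max_left _ _⟩
        have h3 := hF.mul_min_le_integral (Nat.succ_ne_zero p) (le_min hs01.1 ht01.1)
          (max_le hs01.2 ht01.2) hJ
        rw [max_sub_min_eq_abs, abs_sub_comm, min_eq_right hdist] at h3
        have hmin : k (min (i - p) j) ≤ min s t :=
          le_min ((hk.mono (min_le_right _ _)).trans hs.1)
            ((hk.mono (min_le_left _ _)).trans ht.1)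
        have hmax : max s t ≤ k (max i j + 1) :=
          max_le (hs.2.trans (hk.mono (by omega))) (ht.2.trans (hk.mono (by omega)))
        have h4 := hF.integral_mono (hk.nonneg _) hmin min_le_max hmax (hk.le_one _)
        have h5 := hE.integral_le hk hF (show min (i - p) j ≤ max i j + 1 by omega)
        have h6 : ((max i j + 1 : ℕ) : ℝ) - ((min (i - p) j : ℕ) : ℝ) ≤ (p + 1) * (1 + d) := by
          have h7 : max i j + 1 ≤ spanDist i j + p + 1 + min (i - p) j := by
            rw [spanDist]
            omega
          have h8 : ((max i j + 1 : ℕ) : ℝ) ≤ d + p + 1 + ((min (i - p) j : ℕ) : ℝ) := by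
            rw [hd]
            exact_mod_cast h7
          have : 0 ≤ (p : ℝ) * d := by positivity
          linarith
        have h9 : N * (y * (y ^ (p + 1) / (2 * L))) ≤ 2 * (S * (p + 1) * (1 + d)) := by
          have e : N * (2 * ((p + 1) * (1 + d) * (S / N))) = 2 * (S * (p + 1) * (1 + d)) := by
            field_simp
          rw [← e]
          refine mul_le_mul_of_nonneg_left ?_ hN0.le
          refine h3.trans (mul_le_mul_of_nonneg_left (h4.trans (h5.trans ?_)) zero_le_two)
          gcongr
        have e : N * (y * (y ^ (p + 1) / (2 * L))) = N * y ^ (p + 2) / (2 * L) := by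
          rw [pow_succ y (p + 1)]
          ring
        rw [e, div_le_iff₀ (by positivity)] at h9
        calc N * (m ^ (p + 1) * y) ≤ N * (y ^ (p + 1) * y) := by gcongr; linarith
          _ = N * y ^ (p + 2) := by ring
          _ ≤ 2 * (S * (p + 1) * (1 + d)) * (2 * L) := h9
          _ = 4 * (L * (S * (p + 1)) * (1 + d)) := by ring
          _ ≤ 8 * (L * (S * (p + 1)) * (1 + d)) := by gcongr; norm_num
          _ = _ := by ring
    calc N * (m ^ (2 * p) * width k i * y)
        = m ^ (p - 1) * width k i * (N * (m ^ (p + 1) * y)) := by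
          rw [show 2 * p = (p - 1) + (p + 1) by omega, pow_add]
          ring
      _ ≤ Φ ^ (p - 1) * 1 * (8 * L * (S * (p + 1)) * (1 + d)) := by gcongr
      _ = 8 * L * Φ ^ (p - 1) * S * (p + 1) * (1 + d) := by ring
      _ ≤ (2 * Φ ^ (2 * p) * S * (p + 1) + 8 * L * Φ ^ (p - 1) * S * (p + 1)) * (1 + d) := by
          gcongr
          linarith
      _ = _ := by ring

/-- The local errors `∫ F^{p+1}` of the quasi-interpolant, compared between spans. -/
lemma Equidistributes.sq_integral_pow_mul_width_le (hp : 1 ≤ p) (hk : IsClamped p n k)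
    (hF : IsDensity (p + 1) L Φ F) (hE : Equidistributes F p n k) {i j : ℕ} (hpi : p ≤ i)
    (hpj : p ≤ j) (hjn : j < n) :
    (∫ t in k (i - p)..k (i + 1), F t ^ (p + 1)) ^ 2 * width k i
      ≤ (2 * Φ ^ (2 * p) + 8 * L * Φ ^ (p - 1)) * (p + 1) ^ 3
        * ((∫ t in (0 : ℝ)..1, F t) / ((n : ℝ) - p)) ^ 2 * (1 + spanDist i j) * width k j := by
  have hpn : (p : ℝ) < n := by exact_mod_cast hk.lt
  obtain ⟨t, ht, htmax⟩ := hF.exists_max hk (show i - p ≤ i + 1 by omega)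
  obtain ⟨s, hs, hsmax⟩ := hF.exists_max hk (Nat.le_succ j)
  have h1 := hE.integral_pow_le hk hF hpi htmax
  have h2 := hE.mul_pow_mul_width_le hp hk hF hpi ht hs
  set S := ∫ t in (0 : ℝ)..1, F t with hS
  set N := (n : ℝ) - p with hN
  have hN0 : 0 < N := by rw [hN]; linarith
  have hS0 : 0 ≤ S := intervalIntegral.integral_nonneg zero_le_one fun t _ => hF.nonneg t
  have hwi := hk.width_nonneg i
  have hwj := hk.width_nonneg j
  have hm0 := hF.nonneg t
  set D := (2 * Φ ^ (2 * p) + 8 * L * Φ ^ (p - 1))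
  have hT0 : 0 ≤ ∫ t in k (i - p)..k (i + 1), F t ^ (p + 1) :=
    intervalIntegral.integral_nonneg (hk.mono (by omega)) fun t _ => pow_nonneg (hF.nonneg t) _
  -- the `j`-th span has mass `S / N`, hence width at least `S / (N F s)`
  have h3 : S / N ≤ width k j * F s := by
    rw [← hE j hpj hjn]
    have hle : k j ≤ k (j + 1) := hk.mono (Nat.le_succ j)
    have := intervalIntegral.integral_mono_on hle
      (hF.intervalIntegrable (hk.nonneg j) hle (hk.le_one _))
      (intervalIntegrable_const (c := F s)) hsmax
    rwa [intervalIntegral.integral_const, smul_eq_mul] at this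
  have h4 : S / N * (F t ^ (2 * p) * width k i)
      ≤ S / N * (D * (p + 1) * (1 + spanDist i j) * width k j) := by
    calc S / N * (F t ^ (2 * p) * width k i)
        ≤ (width k j * F s) * (F t ^ (2 * p) * width k i) := by gcongr
      _ = width k j / N * (N * (F t ^ (2 * p) * width k i * F s)) := by
          field_simp
      _ ≤ width k j / N * (D * S * (p + 1) * (1 + spanDist i j)) := by gcongr
      _ = _ := by ring
  calc (∫ t in k (i - p)..k (i + 1), F t ^ (p + 1)) ^ 2 * width k i
      ≤ (F t ^ p * ((p + 1) * (S / N))) ^ 2 * width k i := by gcongr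
    _ = (p + 1) ^ 2 * (S / N) * (S / N * (F t ^ (2 * p) * width k i)) := by ring
    _ ≤ (p + 1) ^ 2 * (S / N) * (S / N * (D * (p + 1) * (1 + spanDist i j) * width k j)) := by
        gcongr
    _ = _ := by ring

end Density

/-! ### Error bounds for equidistributing knots -/

lemma exists_ratio (p : ℕ) {ε : ℝ} (hε : 0 < ε) :
    ∃ ρ : ℝ, 0 < ρ ∧ ρ < 1 ∧ 1 ≤ (1 + ε) * ρ ^ p := by
  have hcont : Filter.Tendsto (fun ρ : ℝ => (1 + ε) * ρ ^ p) (nhdsWithin 1 (Iio 1))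
      (nhds ((1 + ε) * 1 ^ p)) :=
    ((continuous_const.mul (continuous_pow p)).tendsto 1).mono_left nhdsWithin_le_nhds
  have h1 := hcont.eventually_const_le (u := 1) (by rw [one_pow]; linarith)
  have h2 : ∀ᶠ ρ : ℝ in nhdsWithin 1 (Iio 1), 0 < ρ :=
    nhdsWithin_le_nhds (lt_mem_nhds zero_lt_one)
  obtain ⟨ρ, ⟨h1, h2⟩, h3⟩ := ((h1.and h2).and self_mem_nhdsWithin).exists
  exact ⟨ρ, h2, h3, h1⟩

/-- Exponential weights with ratio close to one vary slowly over `p` consecutive indices. -/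
lemma abs_pow_spanDist_sub_le {p : ℕ} {ε ρ : ℝ} (hε : 0 < ε) (hρ0 : 0 < ρ) (hρ1 : ρ < 1)
    (hρ : 1 ≤ (1 + ε) * ρ ^ p) (m : ℕ) {i j : ℕ} (hji : j ≤ i) (hij : i ≤ j + p) :
    |ρ ^ spanDist j m - ρ ^ spanDist i m| ≤ ε * ρ ^ spanDist i m := by
  have key : ∀ a b : ℕ, b ≤ a + p → ρ ^ a ≤ (1 + ε) * ρ ^ b := by
    intro a b hab
    have h1 : ρ ^ (a + p) ≤ ρ ^ b := pow_le_pow_of_le_one hρ0.le hρ1.le hab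
    have h2 : 0 < ρ ^ a := pow_pos hρ0 a
    calc ρ ^ a = ρ ^ a * 1 := (mul_one _).symm
      _ ≤ ρ ^ a * ((1 + ε) * ρ ^ p) := by gcongr
      _ = (1 + ε) * ρ ^ (a + p) := by rw [pow_add]; ring
      _ ≤ (1 + ε) * ρ ^ b := by gcongr
  have h1 := key (spanDist j m) (spanDist i m) (by simp only [spanDist]; omega)
  have h2 := key (spanDist i m) (spanDist j m) (by simp only [spanDist]; omega)
  rw [abs_le]
  constructor
  · rcases le_total (ρ ^ spanDist j m) (ρ ^ spanDist i m) with h | h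
    · nlinarith
    · have := pow_pos hρ0 (spanDist i m)
      nlinarith
  · linarith

lemma sum_comp_spanDist_le {φ : ℕ → ℝ} (h0 : ∀ d, 0 ≤ φ d) (hφ : Summable φ) (s : Finset ℕ)
    (m : ℕ) : ∑ i ∈ s, φ (spanDist i m) ≤ 2 * ∑' d, φ d := by
  have key (t : Finset ℕ) (ht : Set.InjOn (fun i => spanDist i m) t) :
      ∑ i ∈ t, φ (spanDist i m) ≤ ∑' d, φ d := by
    rw [← Finset.sum_image (f := φ) ht]
    exact hφ.sum_le_tsum _ fun d _ => h0 d
  rw [← Finset.sum_filter_add_sum_filter_not s (fun i => i < m), two_mul]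
  refine add_le_add (key _ ?_) (key _ ?_)
  · intro i hi j hj hij
    simp only [Finset.coe_filter, mem_ofPred_eq, spanDist] at hi hj hij
    omega
  · intro i hi j hj hij
    simp only [Finset.coe_filter, mem_ofPred_eq, spanDist] at hi hj hij
    omega

lemma summable_one_add_mul_pow {ρ : ℝ} (hρ0 : 0 < ρ) (hρ1 : ρ < 1) :
    Summable fun d : ℕ => ρ ^ d * (1 + d) := by
  have hρ : ‖ρ‖ < 1 := by rwa [Real.norm_of_nonneg hρ0.le]
  have h := (summable_geometric_of_norm_lt_one hρ).add
    (summable_pow_mul_geometric_of_norm_lt_one 1 hρ)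
  refine h.congr fun d => ?_
  rw [pow_one]
  ring

variable {p n : ℕ} {L Φ : ℝ} {F : ℝ → ℝ} {k : ℕ → ℝ}

/-- Weights for the energy estimate: exponential ones for `p ≥ 1`, while for `p = 0` the splines
decouple and the weight can be concentrated on a single span. -/
lemma exists_weight (p : ℕ) (L Φ : ℝ) {ε : ℝ} (hε : 0 < ε) : ∃ Θ : ℝ, 0 ≤ Θ ∧
    ∀ (F : ℝ → ℝ) (n : ℕ) (k : ℕ → ℝ), IsDensity (p + 1) L Φ F → IsClamped p n k →
    Equidistributes F p n k → ∀ m, p ≤ m → m < n → ∃ ω : ℕ → ℝ, (∀ i, 0 ≤ ω i) ∧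
      (∀ i j, j ≤ i → i ≤ j + p → |ω j - ω i| ≤ ε * ω i) ∧ ω m = 1 ∧
      ∑ i ∈ Finset.Ico p n,
          ω i * ((∫ t in k (i - p)..k (i + 1), F t ^ (p + 1)) ^ 2 * width k i)
        ≤ Θ * ((∫ t in (0 : ℝ)..1, F t) / ((n : ℝ) - p)) ^ 2 * width k m := by
  rcases Nat.eq_zero_or_pos p with rfl | hp
  · refine ⟨1, zero_le_one, fun F n k hF hk hE m hpm hmn =>
      ⟨fun i => if i = m then 1 else 0, fun i => ?_, fun i j hji hij => ?_, if_pos rfl, ?_⟩⟩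
    · dsimp only
      split_ifs <;> norm_num
    · obtain rfl : i = j := by omega
      rw [sub_self, abs_zero]
      dsimp only
      split_ifs <;> linarith
    · have hm := hE m hpm hmn
      simp only [ite_mul, one_mul, zero_mul, Finset.sum_ite_eq', Finset.mem_Ico, hpm, hmn,
        and_self, if_true, Nat.sub_zero, zero_add, pow_one]
      rw [hm]
  · obtain ⟨ρ, hρ0, hρ1, hρ⟩ := exists_ratio p hε
    have hsum := summable_one_add_mul_pow hρ0 hρ1
    have hterm0 : ∀ d : ℕ, 0 ≤ ρ ^ d * (1 + d) := fun d => by positivity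
    set D := (2 * |Φ| ^ (2 * p) + 8 * |L| * |Φ| ^ (p - 1)) * ((p : ℝ) + 1) ^ 3
    have hD : 0 ≤ D := by positivity
    refine ⟨D * (2 * ∑' d : ℕ, ρ ^ d * (1 + d)), mul_nonneg hD
      (mul_nonneg zero_le_two (tsum_nonneg hterm0)), fun F n k hF hk hE m hpm hmn =>
      ⟨fun i => ρ ^ spanDist i m, fun i => by positivity, fun i j hji hij =>
        abs_pow_spanDist_sub_le hε hρ0 hρ1 hρ m hji hij, by simp [spanDist], ?_⟩⟩
    have hΦ : |Φ| = Φ := abs_of_nonneg ((hF.nonneg 0).trans (hF.le 0 (by simp)))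
    have hL : |L| = L := abs_of_pos hF.pos
    have hw := hk.width_nonneg m
    set X := ((∫ t in (0 : ℝ)..1, F t) / ((n : ℝ) - p)) ^ 2
    have hX : 0 ≤ X := sq_nonneg _
    calc ∑ i ∈ Finset.Ico p n, ρ ^ spanDist i m *
            ((∫ t in k (i - p)..k (i + 1), F t ^ (p + 1)) ^ 2 * width k i)
        ≤ ∑ i ∈ Finset.Ico p n, ρ ^ spanDist i m * (D * X * (1 + spanDist i m) * width k m) := by
          refine Finset.sum_le_sum fun i hi => mul_le_mul_of_nonneg_left ?_ (by positivity)
          rw [Finset.mem_Ico] at hi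
          have := hE.sq_integral_pow_mul_width_le hp hk hF hi.1 hpm hmn
          simpa only [D, hΦ, hL] using this
      _ = D * X * width k m * ∑ i ∈ Finset.Ico p n,
            ρ ^ spanDist i m * (1 + (spanDist i m : ℝ)) := by
          rw [Finset.mul_sum]
          exact Finset.sum_congr rfl fun i _ => by ring
      _ ≤ D * X * width k m * (2 * ∑' d : ℕ, ρ ^ d * (1 + d)) := by
          refine mul_le_mul_of_nonneg_left ?_ (by positivity)
          exact sum_comp_spanDist_le (φ := fun d : ℕ => ρ ^ d * (1 + (d : ℝ))) hterm0 hsum _ m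
      _ = _ := by ring

/-- The local error `∫ |γ_{p+1}|` of the quasi-interpolant, when `|γ_{p+1}| = κ F^{p+1}`. -/
lemma integral_abs_deriv_eq {γ : ℕ → ℝ → ℝ} {κ : ℝ} (hk : IsClamped p n k)
    (hκ : ∀ t ∈ Icc (0 : ℝ) 1, |γ (p + 1) t| = κ * F t ^ (p + 1)) (i : ℕ) :
    ∫ t in k (i - p)..k (i + 1), |γ (p + 1) t|
      = κ * ∫ t in k (i - p)..k (i + 1), F t ^ (p + 1) := by
  rw [← intervalIntegral.integral_const_mul]
  refine intervalIntegral.integral_congr fun t ht => ?_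
  rw [uIcc_of_le (hk.mono (by omega))] at ht
  exact hκ t ⟨(hk.nonneg _).trans ht.1, ht.2.trans (hk.le_one _)⟩

lemma abs_sub_quasiInterpolant_le_div {γ : ℕ → ℝ → ℝ} {κ : ℝ} (hκ0 : 0 ≤ κ)
    (hγ : IsDerivSeq (p + 1) γ) (hF : IsDensity (p + 1) L Φ F)
    (hκ : ∀ t ∈ Icc (0 : ℝ) 1, |γ (p + 1) t| = κ * F t ^ (p + 1))
    (hk : IsClamped p n k) (hE : Equidistributes F p n k) {i : ℕ} (hpi : p ≤ i) (hin : i < n)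
    {u : ℝ} (hu : u ∈ Icc (k i) (k (i + 1))) :
    |γ 0 u - (splinePoly k i p n (fun j => pairing p γ (dualPoly k p j) (k j))).eval u|
      ≤ κ * Φ ^ p * (p + 1) * ((∫ t in (0 : ℝ)..1, F t) / ((n : ℝ) - p)) := by
  have h1 := abs_sub_quasiInterpolant_le hk hγ hpi hin hu
  rw [integral_abs_deriv_eq hk hκ] at h1
  have h2 := hE.integral_pow_le hk hF hpi (m := Φ) fun s hs =>
    hF.le s ⟨(hk.nonneg _).trans hs.1, hs.2.trans (hk.le_one _)⟩
  rw [eval_splinePoly]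
  refine h1.trans ((mul_le_mul_of_nonneg_left h2 hκ0).trans_eq ?_)
  ring

lemma IsBestUniform.abs_sub_spline_le {γ : ℕ → ℝ → ℝ} {κ : ℝ} (hκ0 : 0 ≤ κ)
    (hγ : IsDerivSeq (p + 1) γ) (hF : IsDensity (p + 1) L Φ F)
    (hκ : ∀ t ∈ Icc (0 : ℝ) 1, |γ (p + 1) t| = κ * F t ^ (p + 1))
    (hk : IsClamped p n k) (hE : Equidistributes F p n k) {P : Fin n → ℝ}
    (hP : IsBestUniform (p + 1) n k (γ 0) P) {u : ℝ} (hu : u ∈ Icc (0 : ℝ) 1) :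
    |γ 0 u - spline (p + 1) n k P u|
      ≤ κ * Φ ^ p * (p + 1) * ((∫ t in (0 : ℝ)..1, F t) / ((n : ℝ) - p)) := by
  refine hP (fun j => pairing p γ (dualPoly k p j) (k j)) _ (fun v hv => ?_) u hu
  obtain ⟨i, hpi, hin, hi⟩ := hk.exists_onSpan hv
  rw [spline_coe_eq_eval hk hi (fun j => pairing p γ (dualPoly k p j) (k j))]
  exact abs_sub_quasiInterpolant_le_div hκ0 hγ hF hκ hk hE hpi hin hi.mem_Icc

lemma IsBestL2.exists_abs_sub_spline_le {γ : ℕ → ℝ → ℝ} {κ : ℝ} (hκ0 : 0 ≤ κ)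
    (hγ : IsDerivSeq (p + 1) γ) (hF : IsDensity (p + 1) L Φ F)
    (hκ : ∀ t ∈ Icc (0 : ℝ) 1, |γ (p + 1) t| = κ * F t ^ (p + 1)) (M : ℝ) :
    ∃ A : ℝ, 0 ≤ A ∧ ∀ (n : ℕ) (k : ℕ → ℝ), IsClamped p n k → IsQuasiUniform M p n k →
      Equidistributes F p n k → ∀ P : Fin n → ℝ, IsBestL2 (p + 1) n k (γ 0) P →
      ∀ u ∈ Icc (0 : ℝ) 1, |γ 0 u - spline (p + 1) n k P u|
        ≤ A * ((∫ t in (0 : ℝ)..1, F t) / ((n : ℝ) - p)) := by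
  obtain ⟨K, hK, hstab⟩ := exists_sq_coeff_mul_width_le p M
  set ε := √(1 / (8 * K)) with hε
  have hε0 : 0 < ε := Real.sqrt_pos.2 (by positivity)
  have hεK : 8 * ε ^ 2 * K ≤ 1 := by
    rw [hε, Real.sq_sqrt (by positivity)]
    exact le_of_eq (by field_simp)
  obtain ⟨Θ, hΘ, hweight⟩ := exists_weight p L Φ hε0
  have hΦ0 : 0 ≤ Φ := (hF.nonneg 0).trans (hF.le 0 (by simp))
  refine ⟨κ * Φ ^ p * (p + 1) + √(8 * K * (κ ^ 2 * Θ)), by positivity,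
    fun n k hk hM hE P hP u hu => ?_⟩
  obtain ⟨m, hpm, hmn, hm⟩ := hk.exists_onSpan hu
  obtain ⟨ω, hω0, hω, hωm, hωsum⟩ := hweight F n k hF hk hE m hpm hmn
  have hpn : (p : ℝ) < n := by exact_mod_cast hk.lt
  have hX0 : 0 ≤ (∫ t in (0 : ℝ)..1, F t) / ((n : ℝ) - p) := div_nonneg
    (intervalIntegral.integral_nonneg zero_le_one fun t _ => hF.nonneg t) (by linarith)
  set X := (∫ t in (0 : ℝ)..1, F t) / ((n : ℝ) - p)
  have hg : ContinuousOn (γ 0) (Icc 0 1) := hγ.continuousOn 0 (Nat.zero_le _)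
  set a : ℕ → ℝ := fun j => pairing p γ (dualPoly k p j) (k j)
  set c : ℕ → ℝ := fun j => extendCoeff P j + (-1) * a j
  have hc (i : ℕ) (v : ℝ) : (splinePoly k i p n c).eval v
      = (splinePoly k i p n (extendCoeff P)).eval v + (-1) * (splinePoly k i p n a).eval v :=
    splinePoly_add_smul k i p n _ _ _ v
  have horth (d : ℕ → ℝ) : ∑ i ∈ Finset.Ico p n, ∫ v in k i..k (i + 1),
      ((γ 0 v - (splinePoly k i p n a).eval v) - (splinePoly k i p n c).eval v)
        * (splinePoly k i p n d).eval v = 0 := by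
    rw [← hP.orthogonal hk hg d]
    refine Finset.sum_congr rfl fun i _ => intervalIntegral.integral_congr fun v _ => ?_
    simp only [hc]
    ring
  have hsq := sq_eval_splinePoly_le hk hK hε0.le hεK (c := c)
    (fun i hpi hin j hji hij => hstab n k hk hM i hpi hin c j hji hij)
    (e := fun i v => γ 0 v - (splinePoly k i p n a).eval v)
    (fun i _ _ => (hg.mono (Icc_subset_Icc (hk.nonneg _) (hk.le_one _))).sub
      (Polynomial.continuousOn _)) horth hω0 (fun i _ _ j hji hij => hω i j hji hij)
    (E := fun i => κ * ∫ t in k (i - p)..k (i + 1), F t ^ (p + 1))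
    (fun i hpi hin v hv => by
      rw [← integral_abs_deriv_eq hk hκ, eval_splinePoly]
      exact abs_sub_quasiInterpolant_le hk hγ hpi hin hv) hpm hmn hωm hm.mem_Icc
  have hwm : 0 < width k m := sub_pos.2 (hk.lt_succ m hpm hmn)
  have hsum : ∑ i ∈ Finset.Ico p n, ω i *
      ((κ * ∫ t in k (i - p)..k (i + 1), F t ^ (p + 1)) ^ 2 * width k i)
      = κ ^ 2 * ∑ i ∈ Finset.Ico p n, ω i *
      ((∫ t in k (i - p)..k (i + 1), F t ^ (p + 1)) ^ 2 * width k i) := by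
    rw [Finset.mul_sum]
    exact Finset.sum_congr rfl fun i _ => by ring
  rw [hsum] at hsq
  have hs2 : ((splinePoly k m p n c).eval u) ^ 2 ≤ 8 * K * (κ ^ 2 * Θ) * X ^ 2 := by
    refine le_of_mul_le_mul_right (hsq.trans ?_) hwm
    calc 8 * K * (κ ^ 2 * ∑ i ∈ Finset.Ico p n, ω i *
          ((∫ t in k (i - p)..k (i + 1), F t ^ (p + 1)) ^ 2 * width k i))
        ≤ 8 * K * (κ ^ 2 * (Θ * X ^ 2 * width k m)) := by gcongr
      _ = _ := by ring
  have hs : |(splinePoly k m p n c).eval u| ≤ √(8 * K * (κ ^ 2 * Θ)) * X := by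
    refine (Real.abs_le_sqrt hs2).trans_eq ?_
    rw [Real.sqrt_mul (by positivity), Real.sqrt_sq hX0]
  have he := abs_sub_quasiInterpolant_le_div hκ0 hγ hF hκ hk hE hpm hmn hm.mem_Icc
  rw [spline_eq_eval hk hm]
  have e : γ 0 u - (splinePoly k m p n (extendCoeff P)).eval u
      = (γ 0 u - (splinePoly k m p n a).eval u) - (splinePoly k m p n c).eval u := by
    rw [hc]
    ring
  rw [e]
  refine (abs_sub _ _).trans ((add_le_add he hs).trans_eq ?_)
  ring

/-! ### The derivative-informed knots -/

/-- The derivatives of `u ↦ f (a + u (b - a))`. -/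
noncomputable def pullbackDeriv (a b : ℝ) (f : ℝ → ℝ) (r : ℕ) (u : ℝ) : ℝ :=
  (b - a) ^ r * iteratedDerivWithin r f (Icc a b) (a + u * (b - a))

section Concrete

variable {q : ℕ} {a b : ℝ} {f : ℝ → ℝ}

lemma add_mul_mem_Icc (hab : a < b) {u : ℝ} (hu : u ∈ Icc (0 : ℝ) 1) :
    a + u * (b - a) ∈ Icc a b := by
  constructor <;> nlinarith [hu.1, hu.2]

lemma pullbackDeriv_zero (u : ℝ) : pullbackDeriv a b f 0 u = pullback a b f u := by
  simp [pullbackDeriv, pullback]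

lemma continuousOn_pullbackDeriv (hab : a < b) {m : ℕ}
    (hf : ContDiffOn ℝ (m : WithTop ℕ∞) f (Icc a b)) {r : ℕ} (hr : r ≤ m) :
    ContinuousOn (pullbackDeriv a b f r) (Icc 0 1) :=
  continuousOn_const.mul ((hf.continuousOn_iteratedDerivWithin (by exact_mod_cast hr)
    (uniqueDiffOn_Icc hab)).comp (by fun_prop) fun _ hu => add_mul_mem_Icc hab hu)

lemma hasDerivWithinAt_pullbackDeriv (hab : a < b) {m : ℕ}
    (hf : ContDiffOn ℝ (m : WithTop ℕ∞) f (Icc a b)) {r : ℕ} (hr : r < m) {u : ℝ}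
    (hu : u ∈ Icc (0 : ℝ) 1) :
    HasDerivWithinAt (pullbackDeriv a b f r) (pullbackDeriv a b f (r + 1) u) (Icc 0 1) u := by
  have h1 := (hf.differentiableOn_iteratedDerivWithin (m := r) (by exact_mod_cast hr)
    (uniqueDiffOn_Icc hab) _ (add_mul_mem_Icc hab hu)).hasDerivWithinAt
  rw [← iteratedDerivWithin_succ] at h1
  have h2 : HasDerivWithinAt (fun u : ℝ => a + u * (b - a)) (b - a) (Icc 0 1) u := by
    simpa using (((hasDerivAt_id u).mul_const (b - a)).const_add a).hasDerivWithinAt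
  have h3 := (h1.comp u h2 fun _ hu => add_mul_mem_Icc hab hu).const_mul ((b - a) ^ r)
  have e : pullbackDeriv a b f (r + 1) u = (b - a) ^ r *
      (iteratedDerivWithin (r + 1) f (Icc a b) (a + u * (b - a)) * (b - a)) := by
    rw [pullbackDeriv, pow_succ]
    ring
  rw [e]
  exact h3

lemma isDerivSeq_pullbackDeriv (hab : a < b) {m : ℕ}
    (hf : ContDiffOn ℝ (m : WithTop ℕ∞) f (Icc a b)) : IsDerivSeq m (pullbackDeriv a b f) where
  continuousOn _ hr := continuousOn_pullbackDeriv hab hf hr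
  hasDerivAt _ hr _ hu := (hasDerivWithinAt_pullbackDeriv hab hf hr
    (Ioo_subset_Icc_self hu)).hasDerivAt (Icc_mem_nhds hu.1 hu.2)

lemma feature_nonneg (u : ℝ) : 0 ≤ feature q a b f u := Real.rpow_nonneg (abs_nonneg _) _

lemma feature_pow (hq : q ≠ 0) (u : ℝ) :
    feature q a b f u ^ q = |iteratedDerivWithin q f (Icc a b) (a + u * (b - a))| := by
  rw [feature, one_div, Real.rpow_inv_natCast_pow (abs_nonneg _) hq]

lemma abs_pullbackDeriv_eq (hab : a < b) (hq : q ≠ 0) (u : ℝ) :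
    |pullbackDeriv a b f q u| = (b - a) ^ q * feature q a b f u ^ q := by
  rw [feature_pow hq, pullbackDeriv, abs_mul, abs_pow, abs_of_pos (sub_pos.2 hab)]

lemma continuousOn_feature (hab : a < b)
    (hf : ContDiffOn ℝ ((q + 1 : ℕ) : WithTop ℕ∞) f (Icc a b)) :
    ContinuousOn (feature q a b f) (Icc 0 1) := by
  have h1 : ContinuousOn (fun u => iteratedDerivWithin q f (Icc a b) (a + u * (b - a))) (Icc 0 1) :=
    (hf.continuousOn_iteratedDerivWithin (by exact_mod_cast Nat.le_succ q)
      (uniqueDiffOn_Icc hab)).comp (by fun_prop) fun _ hu => add_mul_mem_Icc hab hu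
  exact h1.abs.rpow_const fun _ _ => Or.inr (by positivity)

lemma exists_isDensity_feature (hq : q ≠ 0) (hab : a < b)
    (hf : ContDiffOn ℝ ((q + 1 : ℕ) : WithTop ℕ∞) f (Icc a b)) :
    ∃ L Φ : ℝ, IsDensity q L Φ (feature q a b f) := by
  have hcont := continuousOn_feature hab hf
  obtain ⟨Φ, hΦ⟩ := isCompact_Icc.exists_bound_of_continuousOn hcont
  obtain ⟨B, hB⟩ := isCompact_Icc.exists_bound_of_continuousOn
    (continuousOn_pullbackDeriv hab hf (le_refl (q + 1)))
  have hba : 0 < (b - a) ^ q := pow_pos (sub_pos.2 hab) q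
  have hB0 : 0 ≤ B := (norm_nonneg _).trans (hB 0 (by simp))
  refine ⟨(B + 1) / (b - a) ^ q, Φ, hcont, feature_nonneg,
    fun t ht => (le_abs_self _).trans (hΦ t ht), fun x hx y hy => ?_, by positivity⟩
  have hlip := (convex_Icc (0 : ℝ) 1).norm_image_sub_le_of_norm_hasDerivWithin_le
    (fun u hu => hasDerivWithinAt_pullbackDeriv hab hf (Nat.lt_succ_self q) hu) hB hy hx
  rw [Real.norm_eq_abs, Real.norm_eq_abs] at hlip
  have h1 := (abs_abs_sub_abs_le (pullbackDeriv a b f q x) (pullbackDeriv a b f q y)).trans hlip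
  rw [abs_pullbackDeriv_eq hab hq, abs_pullbackDeriv_eq hab hq, ← mul_sub, abs_mul,
    abs_of_pos hba] at h1
  rw [div_mul_eq_mul_div, le_div_iff₀ hba, mul_comm]
  refine h1.trans ?_
  gcongr
  linarith

lemma integral_feature_pos
    (hG : StrictMonoOn (featureCDF q a b f) (Icc 0 1)) :
    0 < ∫ t in (0 : ℝ)..1, feature q a b f t := by
  refine lt_of_le_of_ne
    (intervalIntegral.integral_nonneg zero_le_one fun t _ => feature_nonneg t) fun h => ?_
  have := hG (left_mem_Icc.2 zero_le_one) (right_mem_Icc.2 zero_le_one) zero_lt_one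
  simp [featureCDF, ← h] at this

lemma featureCDF_knots (hab : a < b)
    (hf : ContDiffOn ℝ ((q + 1 : ℕ) : WithTop ℕ∞) f (Icc a b))
    (hG : StrictMonoOn (featureCDF q a b f) (Icc 0 1)) {n i : ℕ} (hi : q ≤ i + 1) (hin : i ≤ n)
    (hqn : q ≤ n) :
    knots q a b f n i ∈ Icc (0 : ℝ) 1 ∧ featureCDF q a b f (knots q a b f n i)
      = ((i : ℝ) - q + 1) / ((n : ℝ) - q + 1) := by
  have hS := integral_feature_pos hG
  have hqn' : (q : ℝ) ≤ n := by exact_mod_cast hqn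
  have hG0 : featureCDF q a b f 0 = 0 := by simp [featureCDF]
  have hG1 : featureCDF q a b f 1 = 1 := by
    rw [featureCDF, div_self hS.ne']
  rw [knots]
  split_ifs with h1 h2
  · refine ⟨by simp, ?_⟩
    have h3 : (q : ℝ) = i + 1 := by exact_mod_cast (by omega : q = i + 1)
    rw [hG0, h3]
    ring
  · refine ⟨by simp, ?_⟩
    obtain rfl : i = n := by omega
    rw [hG1, div_self (by linarith)]
  · have hcont : ContinuousOn (featureCDF q a b f) (Icc 0 1) := by
      have hint : IntervalIntegrable (feature q a b f) MeasureTheory.volume 0 1 :=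
        (continuousOn_feature hab hf).intervalIntegrable_of_Icc zero_le_one
      have := intervalIntegral.continuousOn_primitive_interval (a := 0) (b := 1)
        (f := feature q a b f) (μ := MeasureTheory.volume)
        ((intervalIntegrable_iff_integrableOn_Icc_of_le zero_le_one).1 hint |> fun h => by
          rwa [uIcc_of_le zero_le_one])
      rw [uIcc_of_le zero_le_one] at this
      exact this.div_const _
    have hiq : (q : ℝ) ≤ i := by exact_mod_cast not_lt.1 h1
    have hin' : (i : ℝ) ≤ n := by exact_mod_cast hin
    have hmem : ((i : ℝ) - q + 1) / ((n : ℝ) - q + 1) ∈ featureCDF q a b f '' Icc 0 1 := by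
      refine intermediate_value_Icc zero_le_one hcont ?_
      rw [hG0, hG1]
      exact ⟨div_nonneg (by linarith) (by linarith), (div_le_one (by linarith)).2 (by linarith)⟩
    exact ⟨Function.invFunOn_mem hmem, Function.invFunOn_eq hmem⟩

lemma isClamped_knots {p n : ℕ} (hab : a < b)
    (hf : ContDiffOn ℝ ((p + 1 + 1 : ℕ) : WithTop ℕ∞) f (Icc a b))
    (hG : StrictMonoOn (featureCDF (p + 1) a b f) (Icc 0 1)) (hpn : p + 1 ≤ n) :
    IsClamped p n (knots (p + 1) a b f n) := by
  have h0 : ∀ i ≤ p, knots (p + 1) a b f n i = 0 := fun i hi => by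
    rw [knots, if_pos (by omega)]
  have h1 : ∀ i, n ≤ i → knots (p + 1) a b f n i = 1 := fun i hi => by
    rw [knots, if_neg (by omega), if_pos hi]
  have hlt : ∀ i, p ≤ i → i < n →
      knots (p + 1) a b f n i < knots (p + 1) a b f n (i + 1) := by
    intro i hpi hin
    obtain ⟨m1, e1⟩ := featureCDF_knots hab hf hG (i := i) (by omega) hin.le hpn
    obtain ⟨m2, e2⟩ := featureCDF_knots hab hf hG (i := i + 1) (by omega) hin hpn
    rw [← hG.lt_iff_lt m1 m2, e1, e2]
    have hpn' : ((p + 1 : ℕ) : ℝ) ≤ n := by exact_mod_cast hpn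
    have : 0 < (n : ℝ) - ((p + 1 : ℕ) : ℝ) + 1 := by linarith
    gcongr
    exact Nat.lt_succ_self i
  refine ⟨monotone_nat_of_le_succ fun i => ?_, h0, h1, hlt⟩
  rcases lt_or_ge i p with h | h
  · rw [h0 i h.le, h0 (i + 1) h]
  rcases lt_or_ge i n with h' | h'
  · exact (hlt i h h').le
  · rw [h1 i h', h1 (i + 1) (by omega)]

lemma equidistributes_knots {p n : ℕ} (hab : a < b)
    (hf : ContDiffOn ℝ ((p + 1 + 1 : ℕ) : WithTop ℕ∞) f (Icc a b))
    (hG : StrictMonoOn (featureCDF (p + 1) a b f) (Icc 0 1)) (hpn : p + 1 ≤ n) :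
    Equidistributes (feature (p + 1) a b f) p n (knots (p + 1) a b f n) := by
  intro i hpi hin
  have hS := integral_feature_pos hG
  obtain ⟨m1, e1⟩ := featureCDF_knots hab hf hG (i := i) (by omega) hin.le hpn
  obtain ⟨m2, e2⟩ := featureCDF_knots hab hf hG (i := i + 1) (by omega) hin hpn
  have hpn' : ((p + 1 : ℕ) : ℝ) ≤ n := by exact_mod_cast hpn
  have hint {x : ℝ} (hx : x ∈ Icc (0 : ℝ) 1) :
      IntervalIntegrable (feature (p + 1) a b f) MeasureTheory.volume 0 x :=
    ((continuousOn_feature hab hf).mono (Icc_subset_Icc le_rfl hx.2)).intervalIntegrable_of_Icc hx.1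
  rw [featureCDF, div_eq_iff hS.ne'] at e1 e2
  rw [← intervalIntegral.integral_interval_sub_left (hint m2) (hint m1), e1, e2]
  push_cast at hpn' ⊢
  have h1 : (n : ℝ) - (p + 1) + 1 ≠ 0 := by linarith
  have h2 : (n : ℝ) - p ≠ 0 := by linarith
  rw [show (n : ℝ) - (p + 1) + 1 = n - p by ring]
  field_simp
  ring

lemma LocallyQuasiUniform.isQuasiUniform {M : ℝ} {p n : ℕ} {k : ℕ → ℝ} (hk : IsClamped p n k)
    (h : LocallyQuasiUniform M (p + 1) n k) : IsQuasiUniform (max M 1) p n k where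
  one_le := le_max_right _ _
  left j hpj hjn := (h j (by omega) hjn).1.trans
    (mul_le_mul_of_nonneg_right (le_max_left _ _) (hk.width_nonneg _))
  right j hpj hjn := (h j (by omega) hjn).2.trans
    (mul_le_mul_of_nonneg_right (le_max_left _ _) (hk.width_nonneg _))

end Concrete

end KnotPlacement

theorem mainTheorem1 (q : ℕ) (hq : 1 ≤ q) (a b : ℝ) (hab : a < b) (f : ℝ → ℝ)
    (hf : ContDiffOn ℝ ((q + 1 : ℕ) : WithTop ℕ∞) f (Icc a b))
    (hG : StrictMonoOn (KnotPlacement.featureCDF q a b f) (Icc 0 1)) (M : ℝ) :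
    ∃ A : ℝ, 0 < A ∧ ∀ n : ℕ, q ≤ n →
      KnotPlacement.LocallyQuasiUniform M q n (KnotPlacement.knots q a b f n) →
      ∀ P : Fin n → ℝ,
        (KnotPlacement.IsBestUniform q n (KnotPlacement.knots q a b f n)
            (KnotPlacement.pullback a b f) P ∨
          KnotPlacement.IsBestL2 q n (KnotPlacement.knots q a b f n)
            (KnotPlacement.pullback a b f) P) →
        ∀ j : ℕ, q ≤ j + 1 → j + 1 ≤ n →
          ∀ u ∈ Icc (KnotPlacement.knots q a b f n j) (KnotPlacement.knots q a b f n (j + 1)),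
            |KnotPlacement.pullback a b f u
                - KnotPlacement.spline q n (KnotPlacement.knots q a b f n) P u|
              ≤ A * ((∫ t in (0 : ℝ)..1, KnotPlacement.feature q a b f t) /
                ((n : ℝ) - q + 1)) := by
  obtain ⟨p, rfl⟩ : ∃ p, q = p + 1 := ⟨q - 1, by omega⟩
  obtain ⟨L, Φ, hF⟩ := KnotPlacement.exists_isDensity_feature (Nat.succ_ne_zero p) hab hf
  have hγ : KnotPlacement.IsDerivSeq (p + 1) (KnotPlacement.pullbackDeriv a b f) :=
    KnotPlacement.isDerivSeq_pullbackDeriv hab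
      (hf.of_le (by exact_mod_cast Nat.le_succ (p + 1)))
  have hγ0 : KnotPlacement.pullbackDeriv a b f 0 = KnotPlacement.pullback a b f :=
    funext KnotPlacement.pullbackDeriv_zero
  have hκ0 : 0 ≤ (b - a) ^ (p + 1) := pow_nonneg (sub_nonneg.2 hab.le) _
  have hκ : ∀ t ∈ Icc (0 : ℝ) 1, |KnotPlacement.pullbackDeriv a b f (p + 1) t|
      = (b - a) ^ (p + 1) * KnotPlacement.feature (p + 1) a b f t ^ (p + 1) :=
    fun t _ => KnotPlacement.abs_pullbackDeriv_eq hab (Nat.succ_ne_zero p) t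
  have hΦ0 : 0 ≤ Φ := (hF.nonneg 0).trans (hF.le 0 (by simp))
  have hS := KnotPlacement.integral_feature_pos hG
  obtain ⟨A, hA, hL2⟩ :=
    KnotPlacement.IsBestL2.exists_abs_sub_spline_le hκ0 hγ hF hκ (max M 1)
  refine ⟨(b - a) ^ (p + 1) * Φ ^ p * (p + 1) + A + 1, by positivity,
    fun n hn hM P hP j _ _ u hu => ?_⟩
  have hk := KnotPlacement.isClamped_knots hab hf hG hn
  have hE := KnotPlacement.equidistributes_knots hab hf hG hn
  have hu01 : u ∈ Icc (0 : ℝ) 1 := ⟨(hk.nonneg _).trans hu.1, hu.2.trans (hk.le_one _)⟩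
  have hN : (n : ℝ) - ((p + 1 : ℕ) : ℝ) + 1 = n - p := by
    push_cast
    ring
  have hpn : (p : ℝ) < n := by exact_mod_cast hk.lt
  have hX0 : 0 ≤ (∫ t in (0 : ℝ)..1, KnotPlacement.feature (p + 1) a b f t) / ((n : ℝ) - p) :=
    div_nonneg hS.le (by linarith)
  rw [hN]
  rw [← hγ0] at hP ⊢
  have hB0 : 0 ≤ (b - a) ^ (p + 1) * Φ ^ p * (p + 1) := by positivity
  rcases hP with hP | hP
  · refine (hP.abs_sub_spline_le hκ0 hγ hF hκ hk hE hu01).trans ?_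
    gcongr
    linarith
  · refine (hL2 n _ hk (hM.isQuasiUniform hk) hE P hP u hu01).trans ?_
    gcongr
    linarith
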